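/- Let $(\Omega,\mathcal F,\mathbb P)$ be a $\sigma$-finite measure space (for instance a probability space) with a measurable flow $(\theta_s)_{s\in\mathbb R}$: maps $\theta_s:\Omega\to\Omega$ such that $(\omega,s)\mapsto\theta_s\omega$ is measurable, $\theta_0=\mathrm{id}$ and $\theta_s\circ\theta_t=\theta_{s+t}$. Assume that $\mathbb P$ is stationary ($\mathbb P\circ\theta_s=\mathbb P$ for all $s$) and ergodic (if $A\in\mathcal F$ satisfies $\theta_sA=A$ for all $s$, then $\mathbb P(A)=0$ or $\mathbb P(A^c)=0$). Let $\xi$ and $\eta$ be random measures on $\mathbb R$, that is, kernels from $\Omega$ to $\mathbb R$ that are finite on compact sets for $\mathbb P$-a.e. $\omega$. Assume that both are invariant, i.e. for $\mathbb P$-a.e. $\omega$, $\xi(\theta_t\omega,C-t)=\xi(\omega,C)$ for all $t\in\mathbb R$ and all Borel sets $C$, and likewise for $\eta$. Assume that for $\mathbb P$-a.e. $\omega$ the measures $\xi(\omega,\cdot)$ and $\eta(\omega,\cdot)$ are mutually singular and $\xi(\omega,\cdot)$ is diffuse, and that the intensities are finite and equal: $\mathbb E\,\xi[0,1]=\mathbb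 E\,\eta[0,1]<\infty$. If $\mathbb P(\Omega)=\infty$, assume moreover that $\xi(\omega,\mathbb R)\in\{0,\infty\}$ for $\mathbb P$-a.e. $\omega$ (for finite $\mathbb P$ nothing of the kind has to be assumed). Define $$\tau(\omega,s):=\inf\{t>s:\ \xi(\omega,[s,t])\le\eta(\omega,[s,t])\},\qquad s\in\mathbb R,\qquad \inf\emptyset:=\infty .$$ Then $\tau$ is an allocation: it takes values in $\mathbb R\cup\{\infty\}$, it is jointly measurable in $(\omega,s)$ after modification for $\omega$ in a $\mathbb P$-null set, and for $\mathbb P$-a.e. $\omega$ one has $\tau(\theta_t\omega,s-t)=\tau(\omega,s)-t$ for all $s,t\in\mathbb R$. Moreover $\tau$ balances $\xi$ and $\eta$: for $\mathbb P$-a.e. $\omega$, $$\xi(\omega,\{s:\tau(\omega,s)=\infty\})=0\qquad\text{and}\qquad \xi(\omega,\{s:\tau(\omega,s)\in C\})=\eta(\omega,C)\ \text{ for all Borel } C\subset\mathbb R .$$ The target $\eta$ may have atoms. -/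

import Mathlib

open MeasureTheory ProbabilityTheory
open scoped ENNReal

namespace RandomTransport

/-- A measurable flow `θ` on `Ω` indexed by `ℝ`. -/
structure IsMeasurableFlow {Ω : Type*} [MeasurableSpace Ω] (θ : ℝ → Ω → Ω) : Prop where
  measurable : Measurable (fun p : Ω × ℝ => θ p.2 p.1)
  zero : ∀ ω, θ 0 ω = ω
  comp : ∀ s t ω, θ s (θ t ω) = θ (s + t) ω

/-- The measure `P` is stationary under the flow. -/
def IsStationary {Ω : Type*} [MeasurableSpace Ω] (P : Measure Ω) (θ : ℝ → Ω → Ω) : Prop :=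
  ∀ s, MeasurePreserving (θ s) P P

/-- The measure `P` is ergodic: every measurable set that is invariant under the flow
is null or has null complement. As `θ s` is a bijection with inverse `θ (-s)`, invariance under
all preimages is the same as invariance under all images. -/
def IsErgodic {Ω : Type*} [MeasurableSpace Ω] (P : Measure Ω) (θ : ℝ → Ω → Ω) : Prop :=
  ∀ A : Set Ω, MeasurableSet A → (∀ s, θ s ⁻¹' A = A) → P A = 0 ∨ P Aᶜ = 0

/-- A random measure on `ℝ`: a kernel from `Ω` to `ℝ` that is, for `P`-a.e. `ω`,
finite on compact sets. -/
def IsRandomMeasure {Ω : Type*} [MeasurableSpace Ω] (P : Measure Ω) (ξ : Kernel Ω ℝ) : Prop :=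
  ∀ᵐ ω ∂P, ∀ C : Set ℝ, IsCompact C → ξ ω C < ∞

/-- The kernel `ξ` is invariant (flow-adapted): `ξ (θ_t ω, C - t) = ξ (ω, C)`, where
`C - t = {x | x + t ∈ C}`. -/
def IsInvariant {Ω : Type*} [MeasurableSpace Ω] (P : Measure Ω) (θ : ℝ → Ω → Ω)
    (ξ : Kernel Ω ℝ) : Prop :=
  ∀ᵐ ω ∂P, ∀ t : ℝ, ∀ C : Set ℝ, MeasurableSet C → ξ (θ t ω) {x | x + t ∈ C} = ξ ω C

/-- The random measure `ξ` is diffuse: almost surely it has no atoms. -/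
def IsDiffuse {Ω : Type*} [MeasurableSpace Ω] (P : Measure Ω) (ξ : Kernel Ω ℝ) : Prop :=
  ∀ᵐ ω ∂P, ∀ x : ℝ, ξ ω {x} = 0

/-- The random measures `ξ` and `η` are mutually singular, almost surely. -/
def AreMutuallySingular {Ω : Type*} [MeasurableSpace Ω] (P : Measure Ω) (ξ η : Kernel Ω ℝ) :
    Prop :=
  ∀ᵐ ω ∂P, ξ ω ⟂ₘ η ω

/-- The intensity `E ξ[0,1]`. -/
noncomputable def intensity {Ω : Type*} [MeasurableSpace Ω] (P : Measure Ω) (ξ : Kernel Ω ℝ) :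
    ℝ≥0∞ :=
  ∫⁻ ω, ξ ω (Set.Icc 0 1) ∂P

/-- An allocation: an equivariant measurable map with values in `ℝ ∪ {∞}`, the latter being the
extended reals other than `-∞`. Since random measures are only almost surely
locally finite, measurability is joint measurability in `(ω, s)` up to a `P`-null set of `ω`. -/
structure IsAllocation {Ω : Type*} [MeasurableSpace Ω] (P : Measure Ω) (θ : ℝ → Ω → Ω)
    (τ : Ω → ℝ → EReal) : Prop where
  ne_bot : ∀ ω s, τ ω s ≠ ⊥
  measurable : ∃ g : Ω × ℝ → EReal, Measurable g ∧ ∀ᵐ ω ∂P, ∀ s : ℝ, τ ω s = g (ω, s)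
  equivariant : ∀ᵐ ω ∂P, ∀ s t : ℝ, τ (θ t ω) (s - t) = τ ω s - (t : EReal)

/-- The map `τ` balances `ξ` and `η`: for `P`-a.e. `ω`, the value `τ(s)` is finite for
`ξ`-a.e. `s`, and the image of `ξ` under `τ` is `η`. -/
structure Balances {Ω : Type*} [MeasurableSpace Ω] (P : Measure Ω) (ξ η : Kernel Ω ℝ)
    (τ : Ω → ℝ → EReal) : Prop where
  finite : ∀ᵐ ω ∂P, ξ ω {s | τ ω s = ⊤} = 0
  image : ∀ᵐ ω ∂P, ∀ C : Set ℝ, MeasurableSet C →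
    ξ ω {s | ∃ x ∈ C, τ ω s = (x : EReal)} = η ω C

/-- `τ(s) = inf {t > s : ξ[s,t] ≤ η[s,t]}`, with `inf ∅ = ∞`. -/
noncomputable def matching {Ω : Type*} [MeasurableSpace Ω] (ξ η : Kernel Ω ℝ) (ω : Ω) (s : ℝ) :
    EReal :=
  sInf ((fun t : ℝ => (t : EReal)) '' {t : ℝ | s < t ∧ ξ ω (Set.Icc s t) ≤ η ω (Set.Icc s t)})

end RandomTransport

/-!
Fix a path and write `f` for the function with increments `ξ(x, y] - η(x, y]`. It is
right-continuous and, as `ξ` is diffuse, it only jumps downwards; off the atoms of `η` the matching is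
`τ(s) = inf {t > s : f(t) ≤ f(s)}`. The pathwise core is `measure_unmatchedAt`: the `ξ`-mass which
has arrived in `(a, t]` and is not matched at time `t` is `f(t) - inf_{[a,t]} f`. Indeed, as a
function of `s`, the infimum `F(s)` of `f` over `[s, t]` is continuous and nondecreasing, with
`dF ≤ dξ`; it is constant to the right of every point which is matched by time `t`, and on the set
of unmatched points `dξ ≤ dF + dη`, where mutual singularity removes `dη`. Taking differences, the
`ξ`-mass in `(c, b]` matched into `(a, b]` is `η(a, b] + inf_{[c,b]} f - inf_{[c,a]} f`. Two
consequences follow.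

* The image of `ξ` under `τ` is always at most `η` (`realImage_pathMatching_le`).
* It is equal to `η` if unmatched points occur arbitrarily far to the left, since then the two
  infima agree for suitable `c` (`le_realImage_pathMatching`).

On the probabilistic side, the mass transport principle (`tsum_lintegral_transport`) shows that the
intensity of the image is that of the matched part of `ξ`. By ergodicity there is either almost
surely no unmatched `ξ`-mass or almost surely some. In the latter case Poincaré recurrence
(`measure_inter_Iic_ne_zero`, which is where infinite `P` needs the assumption on `ξ(ℝ)`) makes the
image equal to `η`, so the matched part of `ξ` has the full intensity, a contradiction. Hence
almost all of `ξ` is matched, and the image is at most `η` with the same finite intensity, so it is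
`η`.
-/

namespace RandomTransport

open Set Filter Topology

/-! ### Measures on the line and their distribution functions -/

/-- Every locally finite measure on the line is the Stieltjes measure of its distribution
function, normalised to vanish at `0`. -/
lemma exists_stieltjesFunction_measure_eq (μ : Measure ℝ) [IsLocallyFiniteMeasure μ] :
    ∃ F : StieltjesFunction ℝ, F.measure = μ := by
  set F : ℝ → ℝ := fun x => if 0 ≤ x then μ.real (Ioc 0 x) else -μ.real (Ioc x 0) with hF
  have fin : ∀ a b, μ (Ioc a b) ≠ ∞ := fun a b => measure_Ioc_lt_top.ne
  have add : ∀ a b c, a ≤ b → b ≤ c → μ.real (Ioc a c) = μ.real (Ioc a b) + μ.real (Ioc b c) := by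
    intro a b c hab hbc
    rw [← Ioc_union_Ioc_eq_Ioc hab hbc, measureReal_union _ measurableSet_Ioc (fin _ _) (fin _ _)]
    exact Ioc_disjoint_Ioc_of_le le_rfl
  have incr : ∀ x y, x ≤ y → F y = F x + μ.real (Ioc x y) := by
    intro x y hxy
    simp only [hF]
    split_ifs with hy hx hx
    · exact add _ _ _ hx hxy
    · rw [add x 0 y (not_le.1 hx).le hy]; ring
    · exact absurd (hx.trans hxy) hy
    · rw [add x y 0 hxy (not_le.1 hy).le]; ring
  have mono : Monotone F := fun x y hxy => by
    rw [incr x y hxy]; exact le_add_of_nonneg_right measureReal_nonneg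
  have rc : ∀ x, ContinuousWithinAt F (Ici x) x := by
    intro x
    rw [← continuousWithinAt_Ioi_iff_Ici]
    have h1 : Tendsto (μ ∘ fun y => Ioc x y) (𝓝[>] x) (𝓝 (μ (⋂ r > x, Ioc x r))) :=
      tendsto_measure_biInter_gt (fun r _ => measurableSet_Ioc.nullMeasurableSet)
        (fun i j _ hij => Ioc_subset_Ioc_right hij) ⟨x + 1, by simp, fin _ _⟩
    have h2 : (⋂ r > x, Ioc x r) = ∅ := by
      refine eq_empty_of_forall_notMem fun z hz => ?_
      simp only [mem_iInter] at hz
      have hxz : x < z := (hz (x + 1) (by simp)).1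
      have := (hz ((x + z) / 2) (by simp only [gt_iff_lt]; linarith)).2
      linarith
    rw [h2, measure_empty] at h1
    have h3 : Tendsto (fun y => F x + μ.real (Ioc x y)) (𝓝[>] x) (𝓝 (F x + 0)) :=
      tendsto_const_nhds.add ((ENNReal.tendsto_toReal ENNReal.zero_ne_top).comp h1)
    rw [add_zero] at h3
    refine h3.congr' ?_
    filter_upwards [self_mem_nhdsWithin] with y hy
    exact (incr x y (le_of_lt hy)).symm
  refine ⟨⟨F, mono, rc⟩, ?_⟩
  symm
  refine Measure.ext_of_Ioc _ _ fun a b hab => ?_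
  rw [StieltjesFunction.measure_Ioc]
  change _ = ENNReal.ofReal (F b - F a)
  rw [incr a b hab.le, add_sub_cancel_left, measureReal_def, ENNReal.ofReal_toReal (fin _ _)]

/-- Stieltjes measures are monotone in the increments of their distribution functions. -/
lemma stieltjes_measure_mono (F G : StieltjesFunction ℝ)
    (h : ∀ a b, a ≤ b → F b - F a ≤ G b - G a) : F.measure ≤ G.measure := by
  let D : StieltjesFunction ℝ :=
    ⟨fun x => G x - F x, fun a b hab => by have := h a b hab; simp only; linarith,
      fun x => (G.right_continuous x).sub (F.right_continuous x)⟩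
  have hD : G = F + D := by
    ext x
    change G x = F x + (G x - F x)
    ring
  rw [hD, StieltjesFunction.measure_add]
  exact Measure.le_add_right le_rfl

/-- A locally finite measure on the line dominates every measure which is smaller on half-open
intervals. -/
lemma measure_le_of_Ioc_le {μ ν : Measure ℝ} [IsLocallyFiniteMeasure ν]
    (h : ∀ a b, a ≤ b → μ (Ioc a b) ≤ ν (Ioc a b)) : μ ≤ ν := by
  have : IsLocallyFiniteMeasure μ :=
    ⟨fun x => ⟨Ioc (x - 1) (x + 1), Ioc_mem_nhds (by linarith) (by linarith),
      (h _ _ (by linarith)).trans_lt measure_Ioc_lt_top⟩⟩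
  obtain ⟨F, rfl⟩ := exists_stieltjesFunction_measure_eq μ
  obtain ⟨G, rfl⟩ := exists_stieltjesFunction_measure_eq ν
  refine stieltjes_measure_mono F G fun a b hab => ?_
  have := h a b hab
  rwa [StieltjesFunction.measure_Ioc, StieltjesFunction.measure_Ioc,
    ENNReal.ofReal_le_ofReal_iff (sub_nonneg.2 (G.mono hab))] at this

/-- For a continuous distribution function, the mass of an arbitrary set is at most its
oscillation over the set, because the convex hull of the set has no more. -/
lemma stieltjes_measure_le_of_increments_le (G : StieltjesFunction ℝ) (hG : Continuous G)
    {S : Set ℝ} (hS : BddBelow S) (hS' : BddAbove S) {D : ℝ}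
    (h : ∀ x ∈ S, ∀ y ∈ S, x ≤ y → G y - G x ≤ D) : G.measure S ≤ ENNReal.ofReal D := by
  rcases S.eq_empty_or_nonempty with rfl | hne
  · simp
  have hD : 0 ≤ D := by
    obtain ⟨x, hx⟩ := hne
    simpa using h x hx x hx le_rfl
  have h' : ∀ x ∈ S, ∀ y ∈ S, G y - G x ≤ D := by
    intro x hx y hy
    rcases le_total x y with hxy | hxy
    · exact h x hx y hy hxy
    · have := G.mono hxy; linarith
  have h1 : ∀ x ∈ S, ∀ y ∈ closure S, G y - G x ≤ D := fun x hx =>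
    closure_minimal (h' x hx) (isClosed_le (hG.sub continuous_const) continuous_const)
  have h2 : ∀ x ∈ closure S, ∀ y ∈ closure S, G y - G x ≤ D := fun x hx y hy =>
    closure_minimal (t := {x | G y - G x ≤ D}) (fun x hx => h1 x hx y hy)
      (isClosed_le (continuous_const.sub hG) continuous_const) hx
  calc G.measure S ≤ G.measure (Icc (sInf S) (sSup S)) :=
        measure_mono fun x hx => ⟨csInf_le hS hx, le_csSup hS' hx⟩
    _ = ENNReal.ofReal (G (sSup S) - G (sInf S)) := by
        rw [StieltjesFunction.measure_Icc, hG.continuousAt.continuousWithinAt.leftLim_eq]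
    _ ≤ ENNReal.ofReal D := ENNReal.ofReal_le_ofReal
        (h2 _ (csInf_mem_closure hne hS) _ (csSup_mem_closure hne hS'))

/-- A Stieltjes function without jumps is continuous. -/
lemma continuous_of_measure_singleton_eq_zero (G : StieltjesFunction ℝ)
    (h : ∀ x, G.measure {x} = 0) : Continuous G := by
  refine continuous_iff_continuousAt.2 fun x => ?_
  rw [G.mono.continuousAt_iff_leftLim_eq_rightLim, StieltjesFunction.rightLim_eq]
  have := h x
  rw [StieltjesFunction.measure_singleton, ENNReal.ofReal_eq_zero] at this
  exact le_antisymm (G.mono.leftLim_le le_rfl) (by linarith)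

/-! ### Matching on a single path -/

/-- The infimum over the window `[s, t]` of the path `f`; for `t ≤ s` it is `f t`, so that it is
a function of `s` on the whole line. -/
noncomputable def windowInf (f : ℝ → ℝ) (t s : ℝ) : ℝ := sInf (f '' Icc (min s t) t)

/-- The points `s < t` below which the path `f` does not return during `(s, t]`. These are the
starting points of mass which is still unmatched at time `t`. -/
def unmatchedAt (f : ℝ → ℝ) (t : ℝ) : Set ℝ := {s | s < t ∧ ∀ r ∈ Ioc s t, f s < f r}

section Path

variable (G H : StieltjesFunction ℝ)

lemma bddBelow_image_sub (a b : ℝ) : BddBelow ((fun x => G x - H x) '' Icc a b) := by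
  refine ⟨G a - H b, ?_⟩
  rintro _ ⟨r, hr, rfl⟩
  have h1 := G.mono hr.1
  have h2 := H.mono hr.2
  simp only
  linarith

lemma windowInf_le {t s r : ℝ} (hr : min s t ≤ r) (hrt : r ≤ t) :
    windowInf (fun x => G x - H x) t s ≤ G r - H r :=
  csInf_le (bddBelow_image_sub G H _ _) ⟨r, ⟨hr, hrt⟩, rfl⟩

lemma le_windowInf {f : ℝ → ℝ} {t s c : ℝ} (h : ∀ r, min s t ≤ r → r ≤ t → c ≤ f r) :
    c ≤ windowInf f t s := by
  refine le_csInf ⟨f t, t, ⟨min_le_right _ _, le_rfl⟩, rfl⟩ ?_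
  rintro _ ⟨r, hr, rfl⟩
  exact h r hr.1 hr.2

lemma windowInf_mono (t : ℝ) : Monotone (windowInf (fun x => G x - H x) t) := fun _ _ hpq =>
  le_windowInf fun _ hr hrt => windowInf_le G H ((min_le_min_right t hpq).trans hr) hrt

lemma windowInf_self (t : ℝ) : windowInf (fun x => G x - H x) t t = G t - H t := by
  refine le_antisymm (windowInf_le G H (min_le_right _ _) le_rfl) (le_windowInf fun r hr hrt => ?_)
  rw [min_self] at hr
  rw [le_antisymm hrt hr]

/-- The infimum over the longer window `[s, b]` is the smaller one. -/
lemma windowInf_anti {s a b : ℝ} (hsa : s ≤ a) (hab : a ≤ b) :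
    windowInf (fun x => G x - H x) b s ≤ windowInf (fun x => G x - H x) a s :=
  le_windowInf fun r hr hra => windowInf_le G H
    (by rw [min_eq_left hsa] at hr; exact (min_le_left _ _).trans hr) (hra.trans hab)

/-- If the path stays above its value at `s`, the infimum over a window from `s` is that value. -/
lemma windowInf_eq_of_forall_lt {s t : ℝ} (hst : s ≤ t)
    (h : ∀ r, s < r → r ≤ t → G s - H s ≤ G r - H r) :
    windowInf (fun x => G x - H x) t s = G s - H s := by
  refine le_antisymm (windowInf_le G H (min_le_left _ _) hst) (le_windowInf fun r hr hrt => ?_)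
  rw [min_eq_left hst] at hr
  rcases hr.eq_or_lt with rfl | hr
  · exact le_rfl
  · exact h r hr hrt

/-- The increments of the running infimum are dominated by those of the upward part of the
path. -/
lemma windowInf_sub_le {t p q : ℝ} (hpq : p ≤ q) :
    windowInf (fun x => G x - H x) t q - windowInf (fun x => G x - H x) t p ≤ G q - G p := by
  have key : windowInf (fun x => G x - H x) t q - (G q - G p) ≤
      windowInf (fun x => G x - H x) t p := by
    refine le_windowInf fun r hr hrt => ?_
    have hG := G.mono hpq
    rcases le_or_gt (min q t) r with h | h
    · have := windowInf_le G H h hrt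
      linarith
    · have h1 := windowInf_le G H (le_refl (min q t)) (min_le_right q t)
      have hrt' : r < t := h.trans_le (min_le_right _ _)
      have hpr : p ≤ r := by
        rcases min_le_iff.1 hr with h' | h'
        · exact h'
        · exact absurd h' (not_le.2 hrt')
      have h2 := G.mono (min_le_left q t)
      have h3 := H.mono h.le
      have h4 := G.mono hpr
      linarith
  linarith

variable {G}

lemma continuous_windowInf (hG : Continuous G) (t : ℝ) :
    Continuous (windowInf (fun x => G x - H x) t) := by
  refine continuous_iff_continuousAt.2 fun x => ?_
  rw [ContinuousAt, tendsto_iff_dist_tendsto_zero]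
  have h0 : Tendsto (fun y => dist (G y) (G x)) (𝓝 x) (𝓝 0) :=
    tendsto_iff_dist_tendsto_zero.1 hG.continuousAt
  refine squeeze_zero (fun _ => dist_nonneg) (fun y => ?_) h0
  rw [Real.dist_eq, Real.dist_eq]
  rcases le_total x y with h | h
  · rw [abs_of_nonneg (sub_nonneg.2 (windowInf_mono G H t h)),
      abs_of_nonneg (sub_nonneg.2 (G.mono h))]
    exact windowInf_sub_le G H h
  · rw [abs_sub_comm, abs_sub_comm (G y), abs_of_nonneg (sub_nonneg.2 (windowInf_mono G H t h)),
      abs_of_nonneg (sub_nonneg.2 (G.mono h))]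
    exact windowInf_sub_le G H h

variable (G) in
/-- If the path returns during `(s, t]` to its level at `s` or below, then the running infimum is
constant on an interval to the right of `s`. -/
lemma exists_windowInf_eq {s t : ℝ} (hst : s < t) (hs : s ∉ unmatchedAt (fun x => G x - H x) t) :
    ∃ q : ℚ, s < q ∧
      windowInf (fun x => G x - H x) t s = windowInf (fun x => G x - H x) t q := by
  suffices h : ∃ u, s < u ∧
      windowInf (fun x => G x - H x) t u ≤ windowInf (fun x => G x - H x) t s by
    obtain ⟨u, hu, hle⟩ := h
    obtain ⟨q, hq, hqu⟩ := exists_rat_btwn hu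
    exact ⟨q, hq, le_antisymm (windowInf_mono G H t hq.le)
      ((windowInf_mono G H t hqu.le).trans hle)⟩
  simp only [unmatchedAt, mem_ofPred_eq, not_and, not_forall, not_lt] at hs
  obtain ⟨r, hr, hrs⟩ := hs hst
  by_cases hlt : ∃ r' ∈ Ioc s t, G r' - H r' < G s - H s
  · obtain ⟨r', hr', hlt⟩ := hlt
    have hcont : Tendsto (fun x => G x - H x) (𝓝[≥] s) (𝓝 (G s - H s)) :=
      (G.right_continuous s).sub (H.right_continuous s)
    have hev := hcont.eventually (lt_mem_nhds hlt)
    obtain ⟨u, hu, hsub⟩ := (mem_nhdsGE_iff_exists_Ico_subset).1 hev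
    have hsu : s < u := hu
    refine ⟨min u r', lt_min hsu hr'.1, le_windowInf fun x hx hxt => ?_⟩
    rw [min_eq_left hst.le] at hx
    rcases lt_or_ge x (min u r') with h | h
    · have h1 : G r' - H r' < G x - H x := hsub ⟨hx, h.trans_le (min_le_left _ _)⟩
      refine (windowInf_le G H ?_ hr'.2).trans h1.le
      exact (min_le_left _ _).trans (min_le_right _ _)
    · exact windowInf_le G H ((min_le_left _ _).trans h) hxt
  · push Not at hlt
    refine ⟨r, hr.1, le_windowInf fun x hx hxt => ?_⟩
    rw [min_eq_left hst.le] at hx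
    rcases lt_or_ge x r with h | h
    · refine (windowInf_le G H (min_le_left _ _) hr.2).trans (hrs.trans ?_)
      rcases hx.eq_or_lt with rfl | hx
      · exact le_rfl
      · exact hlt x ⟨hx, hxt⟩
    · exact windowInf_le G H ((min_le_left _ _).trans h) hxt

/-- The mass of upward movement which has arrived during `(a, t]` and is not matched at time `t`
is the height of the path at time `t` above its infimum over `[a, t]`. -/
theorem measure_unmatchedAt (hG : Continuous G) (hsing : G.measure ⟂ₘ H.measure) {a t : ℝ}
    (hat : a ≤ t) :
    G.measure (unmatchedAt (fun x => G x - H x) t ∩ Ioc a t) =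
      ENNReal.ofReal (G t - H t - windowInf (fun x => G x - H x) t a) := by
  set f : ℝ → ℝ := fun x => G x - H x with hf
  set R := unmatchedAt f t with hR
  let F : StieltjesFunction ℝ := ⟨windowInf f t, windowInf_mono G H t,
    fun x => (continuous_windowInf H hG t).continuousAt.continuousWithinAt⟩
  have hFapp : ∀ x, F x = windowInf f t x := fun _ => rfl
  have hFc : Continuous F := continuous_windowInf H hG t
  have hFG : F.measure ≤ G.measure :=
    stieltjes_measure_mono F G fun p q hpq => windowInf_sub_le G H hpq
  have hFIoc : F.measure (Ioc a t) = ENNReal.ofReal (G t - H t - windowInf f t a) := by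
    rw [StieltjesFunction.measure_Ioc, hFapp, hFapp, windowInf_self]
  have hFR : ∀ x ∈ R, F x = f x := fun x hx =>
    windowInf_eq_of_forall_lt G H hx.1.le fun r hr hrt => (hx.2 r ⟨hr, hrt⟩).le
  obtain ⟨N, hN, hGN, hHN⟩ := hsing
  rw [← hFIoc]
  apply le_antisymm
  · -- On `R` the increments of `G` are those of `F + H`, hence `G ≤ F + H` as measures on `R`;
    -- singularity removes `H`.
    have hKle : G.measure.restrict R ≤ F.measure + H.measure := by
      rw [← StieltjesFunction.measure_add]
      refine measure_le_of_Ioc_le fun p q hpq => ?_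
      rw [Measure.restrict_apply measurableSet_Ioc, StieltjesFunction.measure_Ioc]
      refine stieltjes_measure_le_of_increments_le G hG ⟨p, fun x hx => hx.1.1.le⟩
        ⟨q, fun x hx => hx.1.2⟩ fun x hx y hy hxy => ?_
      have e1 := hFR x hx.2
      have e2 := hFR y hy.2
      have e3 := F.mono hx.1.1.le
      have e4 := F.mono hy.1.2
      have e5 := H.mono hx.1.1.le
      have e6 := H.mono hy.1.2
      simp only [hf] at e1 e2
      simp only [StieltjesFunction.add_apply]
      linarith
    calc G.measure (R ∩ Ioc a t) = G.measure.restrict R (Ioc a t) := by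
          rw [Measure.restrict_apply measurableSet_Ioc, inter_comm]
      _ ≤ G.measure.restrict R (Ioc a t ∩ Nᶜ) + G.measure.restrict R (Ioc a t ∩ N) := by
          rw [add_comm]
          exact measure_le_inter_add_sdiff _ _ _
      _ ≤ (F.measure + H.measure) (Ioc a t ∩ Nᶜ) + G.measure N := by
          exact add_le_add (hKle _)
            ((Measure.restrict_le_self _).trans (measure_mono inter_subset_right))
      _ ≤ F.measure (Ioc a t) := by
          rw [hGN, add_zero, Measure.add_apply,
            measure_mono_null (inter_subset_right : Ioc a t ∩ Nᶜ ⊆ Nᶜ) hHN, add_zero]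
          exact measure_mono inter_subset_left
  · -- Off `R` the function `F` is locally constant to the right, so `F` is carried by `R`.
    have hnull : F.measure (Ioc a t \ R) = 0 := by
      have hsub : Ioc a t \ R ⊆ {t} ∪ ⋃ q : ℚ, {s | s ∈ Ioc a (q : ℝ) ∧ F s = F q} := by
        rintro s ⟨hs, hsR⟩
        rcases hs.2.eq_or_lt with rfl | hst
        · exact Or.inl rfl
        · obtain ⟨q, hq, hFq⟩ := exists_windowInf_eq G H hst hsR
          exact Or.inr (mem_iUnion.2 ⟨q, ⟨hs.1, hq.le⟩, hFq⟩)
      refine measure_mono_null hsub (measure_union_null ?_ (measure_iUnion_null fun q => ?_))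
      · rw [StieltjesFunction.measure_singleton, hFc.continuousAt.continuousWithinAt.leftLim_eq,
          sub_self, ENNReal.ofReal_zero]
      · have := stieltjes_measure_le_of_increments_le F hFc
          (S := {s | s ∈ Ioc a (q : ℝ) ∧ F s = F q}) (D := 0)
          ⟨a, fun x hx => hx.1.1.le⟩ ⟨q, fun x hx => hx.1.2⟩
          (fun x hx y hy _ => by rw [hx.2, hy.2, sub_self])
        simpa using this
    calc F.measure (Ioc a t) ≤ F.measure (Ioc a t ∩ R) + F.measure (Ioc a t \ R) :=
          measure_le_inter_add_sdiff _ _ _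
      _ ≤ G.measure (R ∩ Ioc a t) := by
          rw [hnull, add_zero, inter_comm]
          exact hFG _

end Path

/-- The matching of two fixed measures: `τ(s) = inf {t > s : μ[s,t] ≤ ν[s,t]}`. -/
noncomputable def pathMatching (μ ν : Measure ℝ) (s : ℝ) : EReal :=
  sInf ((fun t : ℝ => (t : EReal)) '' {t : ℝ | s < t ∧ μ (Icc s t) ≤ ν (Icc s t)})

lemma le_pathMatching (μ ν : Measure ℝ) (s : ℝ) : (s : EReal) ≤ pathMatching μ ν s := by
  refine le_sInf ?_
  rintro _ ⟨t, ht, rfl⟩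
  exact EReal.coe_le_coe_iff.2 ht.1.le

lemma pathMatching_le {μ ν : Measure ℝ} {s t : ℝ} (hst : s < t)
    (h : μ (Icc s t) ≤ ν (Icc s t)) : pathMatching μ ν s ≤ t :=
  sInf_le (mem_image_of_mem _ ⟨hst, h⟩)

lemma measure_Icc_le_iff_sub_leftLim (G H : StieltjesFunction ℝ) {s t : ℝ} (hst : s ≤ t) :
    G.measure (Icc s t) ≤ H.measure (Icc s t) ↔
      G t - Function.leftLim G s ≤ H t - Function.leftLim H s := by
  rw [StieltjesFunction.measure_Icc, StieltjesFunction.measure_Icc,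
    ENNReal.ofReal_le_ofReal_iff (sub_nonneg.2 (H.mono.leftLim_le hst))]

lemma leftLim_eq_of_measure_singleton (H : StieltjesFunction ℝ) {s : ℝ} (hs : H.measure {s} = 0) :
    Function.leftLim H s = H s := by
  rw [StieltjesFunction.measure_singleton, ENNReal.ofReal_eq_zero] at hs
  exact le_antisymm (H.mono.leftLim_le le_rfl) (by linarith)

section Path

variable {G : StieltjesFunction ℝ} (H : StieltjesFunction ℝ)

lemma measure_Icc_le_iff (hG : Continuous G) {s t : ℝ} (hst : s ≤ t) (hs : H.measure {s} = 0) :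
    G.measure (Icc s t) ≤ H.measure (Icc s t) ↔ G t - H t ≤ G s - H s := by
  rw [measure_Icc_le_iff_sub_leftLim G H hst, hG.continuousAt.continuousWithinAt.leftLim_eq,
    leftLim_eq_of_measure_singleton H hs]
  constructor <;> intro h <;> linarith

lemma lt_pathMatching_iff (hG : Continuous G) {s t : ℝ} (hst : s < t) (hs : H.measure {s} = 0) :
    (t : EReal) < pathMatching G.measure H.measure s ↔
      s ∈ unmatchedAt (fun x => G x - H x) t := by
  constructor
  · refine fun h => ⟨hst, fun r hr => ?_⟩
    by_contra hle
    refine absurd h (not_lt.2 (le_trans (pathMatching_le hr.1 ?_) (EReal.coe_le_coe_iff.2 hr.2)))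
    exact (measure_Icc_le_iff H hG hr.1.le hs).2 (not_lt.1 hle)
  · intro h
    have hcont : Tendsto (fun x => G x - H x) (𝓝[≥] t) (𝓝 (G t - H t)) :=
      (G.right_continuous t).sub (H.right_continuous t)
    have hev := hcont.eventually (lt_mem_nhds (h.2 t ⟨hst, le_rfl⟩))
    obtain ⟨u, hu, hsub⟩ := (mem_nhdsGE_iff_exists_Ico_subset).1 hev
    refine (EReal.coe_lt_coe_iff.2 (show t < u from hu)).trans_le (le_sInf ?_)
    rintro _ ⟨r, ⟨hsr, hr⟩, rfl⟩
    rw [measure_Icc_le_iff H hG hsr.le hs] at hr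
    refine EReal.coe_le_coe_iff.2 (not_lt.1 fun hru => not_lt.2 hr ?_)
    rcases le_or_gt r t with hrt | hrt
    · exact h.2 r ⟨hsr, hrt⟩
    · exact hsub ⟨hrt.le, hru⟩

/-- On a single path, the mass of upward movement arriving in `(c, b]` and matched to a point of
`(a, b]` is the mass of downward movement in `(a, b]`, up to the drop of the infimum over `[c, ·]`
between the times `a` and `b`. -/
lemma measureReal_pathMatching_mem_Ioc (hG : Continuous G) (hsing : G.measure ⟂ₘ H.measure)
    (hm : Measurable (pathMatching G.measure H.measure)) {a b c : ℝ} (hca : c ≤ a) (hab : a ≤ b) :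
    G.measure.real (Ioc c b ∩ {s | (a : EReal) < pathMatching G.measure H.measure s ∧
        pathMatching G.measure H.measure s ≤ b}) =
      H b - H a + windowInf (fun x => G x - H x) b c - windowInf (fun x => G x - H x) a c := by
  set τ := pathMatching G.measure H.measure with hτ
  have hsingle : ∀ x, G.measure {x} = 0 := fun x => by
    rw [StieltjesFunction.measure_singleton, hG.continuousAt.continuousWithinAt.leftLim_eq,
      sub_self, ENNReal.ofReal_zero]
  have hatoms : G.measure {s | H.measure {s} ≠ 0} = 0 := by
    have hsub : {s | H.measure {s} ≠ 0} ⊆ {s | Function.leftLim H s ≠ H s} := by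
      intro s hs h
      refine hs ?_
      rw [StieltjesFunction.measure_singleton, h, sub_self, ENNReal.ofReal_zero]
    have : {s | H.measure {s} ≠ 0}.Countable := H.countable_leftLim_ne.mono hsub
    rw [← biUnion_of_singleton {s | H.measure {s} ≠ 0}]
    exact (measure_biUnion_null_iff this).2 fun x _ => hsingle x
  have hun : ∀ t, MeasurableSet {s | (t : EReal) < τ s} := fun t =>
    measurableSet_lt measurable_const hm
  have fin : ∀ (p q : ℝ) (S : Set ℝ), G.measure (Ioc p q ∩ S) ≠ ∞ := fun p q S =>
    ((measure_mono inter_subset_left).trans_lt measure_Ioc_lt_top).ne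
  have real_Ioc : ∀ p q, p ≤ q → G.measure.real (Ioc p q) = G q - G p := fun p q hpq => by
    rw [measureReal_def, StieltjesFunction.measure_Ioc,
      ENNReal.toReal_ofReal (sub_nonneg.2 (G.mono hpq))]
  have unm : ∀ t, c ≤ t → G.measure.real (Ioc c t ∩ {s | (t : EReal) < τ s}) =
      G t - H t - windowInf (fun x => G x - H x) t c := by
    intro t hct
    have h0 : (Ioc c t ∩ {s | (t : EReal) < τ s} : Set ℝ) =ᵐ[G.measure]
        (unmatchedAt (fun x => G x - H x) t ∩ Ioc c t : Set ℝ) := by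
      have h1 : ∀ᵐ s ∂G.measure, H.measure {s} = 0 := hatoms
      have h2 : ∀ᵐ s ∂G.measure, s ≠ t := hsingle t |> fun h => by
        rw [ae_iff]; simpa using h
      filter_upwards [h1, h2] with s hs hst
      refine propext ⟨fun h => ⟨?_, h.1⟩, fun h => ⟨h.2, ?_⟩⟩
      · exact (lt_pathMatching_iff H hG (lt_of_le_of_ne h.1.2 hst) hs).1 h.2
      · exact (lt_pathMatching_iff H hG (lt_of_le_of_ne h.2.2 hst) hs).2 h.1
    rw [measureReal_def, measure_congr h0, measure_unmatchedAt H hG hsing hct,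
      ENNReal.toReal_ofReal]
    exact sub_nonneg.2 (windowInf_le G H (min_le_right _ _) le_rfl)
  -- Points arriving by time `t` split into those matched by time `t` and those not.
  have split : ∀ t, c ≤ t → G.measure.real (Ioc c t \ {s | (t : EReal) < τ s}) =
      H t - G c + windowInf (fun x => G x - H x) t c := by
    intro t hct
    have h1 := measureReal_inter_add_sdiff (μ := G.measure) (s := Ioc c t) (hun t)
      measure_Ioc_lt_top.ne
    rw [unm t hct, real_Ioc c t hct] at h1
    linarith
  have hdiff : Ioc c b ∩ {s | (a : EReal) < τ s ∧ τ s ≤ b} =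
      (Ioc c b \ {s | (b : EReal) < τ s}) \ (Ioc c a \ {s | (a : EReal) < τ s}) := by
    ext s
    constructor
    · rintro ⟨h1, h2, h3⟩
      exact ⟨⟨h1, not_lt.2 h3⟩, fun h => h.2 h2⟩
    · rintro ⟨⟨h1, h2⟩, h3⟩
      refine ⟨h1, ?_, not_lt.1 h2⟩
      by_contra h4
      refine h3 ⟨⟨h1.1, ?_⟩, h4⟩
      exact EReal.coe_le_coe_iff.1 ((le_pathMatching _ _ s).trans (not_lt.1 h4))
  have hsub : Ioc c a \ {s | (a : EReal) < τ s} ⊆ Ioc c b \ {s | (b : EReal) < τ s} :=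
    fun s hs => ⟨⟨hs.1.1, hs.1.2.trans hab⟩, fun h =>
      hs.2 (lt_of_le_of_lt (EReal.coe_le_coe_iff.2 hab) h)⟩
  rw [hdiff, measureReal_sdiff hsub (measurableSet_Ioc.diff (hun a))
    (((measure_mono sdiff_subset).trans_lt measure_Ioc_lt_top).ne), split b (hca.trans hab),
    split a hca]
  ring

end Path

section Image

variable {μ ν : Measure ℝ}

lemma exists_eq_coe_mem_Ioc_iff {a b : ℝ} {z : EReal} :
    (∃ x ∈ Ioc a b, z = (x : EReal)) ↔ (a : EReal) < z ∧ z ≤ b := by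
  constructor
  · rintro ⟨x, hx, rfl⟩
    exact ⟨EReal.coe_lt_coe_iff.2 hx.1, EReal.coe_le_coe_iff.2 hx.2⟩
  · intro h
    induction z with
    | bot => exact absurd h.1 (by simp)
    | top => exact absurd h.2 (by simp)
    | coe x => exact ⟨x, ⟨EReal.coe_lt_coe_iff.1 h.1, EReal.coe_le_coe_iff.1 h.2⟩, rfl⟩

/-- The image of `μ` under an extended real valued map, restricted to the real line. -/
noncomputable def realImage (μ : Measure ℝ) (τ : ℝ → EReal) : Measure ℝ :=
  (μ.map τ).comap Real.toEReal

lemma realImage_apply {τ : ℝ → EReal} (hτ : Measurable τ) {C : Set ℝ} (hC : MeasurableSet C) :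
    realImage μ τ C = μ {s | ∃ x ∈ C, τ s = (x : EReal)} := by
  have hemb : MeasurableEmbedding Real.toEReal := EReal.measurableEmbedding_coe
  rw [realImage, hemb.comap_apply, Measure.map_apply hτ (hemb.measurableSet_image' hC)]
  congr 1
  ext s
  simp only [mem_preimage, mem_image]
  exact exists_congr fun x => and_congr_right fun _ => eq_comm

lemma exists_continuous_stieltjesFunction_measure_eq (μ ν : Measure ℝ)
    [IsLocallyFiniteMeasure μ] [IsLocallyFiniteMeasure ν]
    (hdiff : ∀ x, μ {x} = 0) : ∃ G H : StieltjesFunction ℝ, Continuous G ∧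
      G.measure = μ ∧ H.measure = ν := by
  obtain ⟨G, rfl⟩ := exists_stieltjesFunction_measure_eq μ
  obtain ⟨H, rfl⟩ := exists_stieltjesFunction_measure_eq ν
  exact ⟨G, H, continuous_of_measure_singleton_eq_zero G hdiff, rfl, rfl⟩

/-- A measure below `ν` with the same mass on all unit intervals `(n, n + 1]` is `ν`. -/
lemma eq_of_le_of_unit_intervals [IsLocallyFiniteMeasure ν] (hle : μ ≤ ν)
    (h : ∀ n : ℤ, μ (Ioc (n : ℝ) (n + 1)) = ν (Ioc (n : ℝ) (n + 1))) : μ = ν := by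
  ext C hC
  have key : ∀ n : ℤ, μ (C ∩ Ioc (n : ℝ) (n + 1)) = ν (C ∩ Ioc (n : ℝ) (n + 1)) := by
    intro n
    refine le_antisymm (hle _) ?_
    have h1 := measure_inter_add_sdiff (μ := μ) (Ioc (n : ℝ) (n + 1)) hC
    have h2 := measure_inter_add_sdiff (μ := ν) (Ioc (n : ℝ) (n + 1)) hC
    rw [← h n, ← h1, inter_comm _ C] at h2
    have hfin : ν (Ioc (n : ℝ) (n + 1) \ C) ≠ ∞ :=
      ((measure_mono sdiff_subset).trans_lt measure_Ioc_lt_top).ne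
    refine (ENNReal.add_le_add_iff_right hfin).1 (h2.trans_le ?_)
    gcongr
  have hU : C = ⋃ n : ℤ, C ∩ Ioc (n : ℝ) (n + 1) := by
    rw [← inter_iUnion, iUnion_Ioc_intCast, inter_univ]
  have hd : Pairwise (Function.onFun Disjoint fun n : ℤ => C ∩ Ioc (n : ℝ) (n + 1)) :=
    fun m n hmn => (pairwise_disjoint_Ioc_intCast ℝ hmn).mono inter_subset_right inter_subset_right
  rw [hU, measure_iUnion hd fun n => hC.inter measurableSet_Ioc,
    measure_iUnion hd fun n => hC.inter measurableSet_Ioc]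
  exact tsum_congr key

variable [IsLocallyFiniteMeasure μ] [IsLocallyFiniteMeasure ν]

/-- The matching never sends more mass to a set than the target measure has there. -/
theorem realImage_pathMatching_le (hdiff : ∀ x, μ {x} = 0) (hsing : μ ⟂ₘ ν)
    (hm : Measurable (pathMatching μ ν)) : realImage μ (pathMatching μ ν) ≤ ν := by
  obtain ⟨G, H, hG, rfl, rfl⟩ := exists_continuous_stieltjesFunction_measure_eq μ ν hdiff
  refine measure_le_of_Ioc_le fun a b hab => ?_
  rw [realImage_apply hm measurableSet_Ioc]
  simp only [exists_eq_coe_mem_Ioc_iff]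
  set S := {s | (a : EReal) < pathMatching G.measure H.measure s ∧
    pathMatching G.measure H.measure s ≤ b} with hS
  have hSU : S = ⋃ n : ℕ, Ioc (a - n) b ∩ S := by
    refine subset_antisymm (fun s hs => ?_) (iUnion_subset fun n => inter_subset_right)
    obtain ⟨n, hn⟩ := exists_nat_gt (a - s)
    refine mem_iUnion.2 ⟨n, ⟨by linarith, ?_⟩, hs⟩
    exact EReal.coe_le_coe_iff.1 ((le_pathMatching _ _ s).trans hs.2)
  have hmono : Monotone fun n : ℕ => Ioc (a - n) b ∩ S := fun m n hmn =>
    inter_subset_inter_left _ (Ioc_subset_Ioc_left (by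
      have : (m : ℝ) ≤ n := by exact_mod_cast hmn
      linarith))
  rw [hSU, hmono.measure_iUnion]
  refine iSup_le fun n => ?_
  have hn : a - n ≤ a := by have : (0 : ℝ) ≤ n := n.cast_nonneg; linarith
  have h1 := measureReal_pathMatching_mem_Ioc H hG hsing hm hn hab
  have h2 := windowInf_anti G H hn hab
  rw [StieltjesFunction.measure_Ioc]
  rw [← ENNReal.ofReal_toReal
    ((measure_mono inter_subset_left).trans_lt measure_Ioc_lt_top :
      G.measure (Ioc (a - n) b ∩ S) < ∞).ne]
  refine ENNReal.ofReal_le_ofReal ?_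
  rw [← measureReal_def, h1]
  linarith

/-- If points which are never matched occur arbitrarily far to the left, then the whole target
measure is used: the path stays above its level at such a point, so all downward movement to the
right of the point is absorbed by mass which arrives there. -/
theorem le_realImage_pathMatching (hdiff : ∀ x, μ {x} = 0) (hsing : μ ⟂ₘ ν)
    (hm : Measurable (pathMatching μ ν))
    (h : ∀ x, ∃ c < x, ν {c} = 0 ∧ pathMatching μ ν c = ⊤) :
    ν ≤ realImage μ (pathMatching μ ν) := by
  have hle := realImage_pathMatching_le hdiff hsing hm
  have : IsLocallyFiniteMeasure (realImage μ (pathMatching μ ν)) :=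
    Measure.isLocallyFiniteMeasure_of_le hle
  obtain ⟨G, H, hG, rfl, rfl⟩ := exists_continuous_stieltjesFunction_measure_eq μ ν hdiff
  refine measure_le_of_Ioc_le fun a b hab => ?_
  rw [realImage_apply hm measurableSet_Ioc]
  simp only [exists_eq_coe_mem_Ioc_iff]
  obtain ⟨c, hca, hc, htop⟩ := h a
  have key : ∀ t, c ≤ t → windowInf (fun x => G x - H x) t c = G c - H c := by
    intro t hct
    refine windowInf_eq_of_forall_lt G H hct fun r hcr _ => ?_
    have h1 := (lt_pathMatching_iff H hG hcr hc).1 (by rw [htop]; exact EReal.coe_lt_top r)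
    exact (h1.2 r ⟨hcr, le_rfl⟩).le
  have h1 := measureReal_pathMatching_mem_Ioc H hG hsing hm hca.le hab
  rw [key b (hca.le.trans hab), key a hca.le, add_sub_cancel_right, measureReal_def] at h1
  rw [StieltjesFunction.measure_Ioc, ← h1]
  exact ENNReal.ofReal_toReal_le.trans (measure_mono inter_subset_right)

/-! ### Measurability of the matching -/

/-- A condition involving only countably many values of `μ` and `ν` which says that the path has
come back to its level before `s` during some `[p, q]` with `s < p`. -/
def ReturnsBefore (μ ν : Measure ℝ) (s : ℝ) (q : ℚ) : Prop :=
  ∃ p : ℚ, s < p ∧ ∀ n : ℕ, ∃ r : ℚ, p ≤ r ∧ r ≤ q ∧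
    μ (Icc s r) < ν (Icc s r) + ENNReal.ofReal (1 / ((n : ℝ) + 1))

open Classical in
/-- The matching can be computed from countably many values, since a path without upward jumps
attains its infimum on compact intervals. -/
lemma pathMatching_eq_iInf (hdiff : ∀ x, μ {x} = 0) (s : ℝ) :
    pathMatching μ ν s =
      ⨅ q : ℚ, if ReturnsBefore μ ν s q then (((q : ℝ) : EReal)) else ⊤ := by
  obtain ⟨G, H, hG, rfl, rfl⟩ := exists_continuous_stieltjesFunction_measure_eq μ ν hdiff
  set a := Function.leftLim G s with ha
  set b := Function.leftLim H s with hb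
  have hlt : ∀ r, s ≤ r → ∀ n : ℕ, (G.measure (Icc s r) < H.measure (Icc s r) +
      ENNReal.ofReal (1 / ((n : ℝ) + 1)) ↔ G r - a < H r - b + 1 / ((n : ℝ) + 1)) := by
    intro r hr n
    have h0 : 0 < 1 / ((n : ℝ) + 1) := Nat.one_div_pos_of_nat
    have h1 : 0 ≤ H r - b := sub_nonneg.2 (H.mono.leftLim_le hr)
    rw [StieltjesFunction.measure_Icc, StieltjesFunction.measure_Icc,
      ← ENNReal.ofReal_add h1 h0.le, ENNReal.ofReal_lt_ofReal_iff (by linarith)]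
  apply le_antisymm
  · refine le_iInf fun q => ?_
    split_ifs with hq
    swap
    · exact le_top
    obtain ⟨p, hsp, hp⟩ := hq
    have hpq : (p : ℝ) ≤ q := by
      obtain ⟨r, h1, h2, -⟩ := hp 0
      exact_mod_cast h1.trans h2
    have hlsc : LowerSemicontinuous fun x => G x - H x := by
      intro x y hy
      have hy' : H x < G x - y := by linarith
      obtain ⟨z, hz1, hz2⟩ := exists_between hy'
      have e1 : ∀ᶠ u in 𝓝 x, z < G u - y :=
        ((hG.sub continuous_const).continuousAt (x := x)).eventually (lt_mem_nhds hz2)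
      have e2 : ∀ᶠ u in 𝓝 x, H u < z := by
        rw [← nhdsLE_sup_nhdsGE, eventually_sup]
        refine ⟨?_, (H.right_continuous x).eventually (gt_mem_nhds hz1)⟩
        filter_upwards [self_mem_nhdsWithin] with u hu
        exact (H.mono hu).trans_lt hz1
      filter_upwards [e1, e2] with u h1 h2
      linarith
    obtain ⟨t, ht, hmin⟩ := (hlsc.lowerSemicontinuousOn (Icc (p : ℝ) q)).exists_isMinOn
      ⟨(p : ℝ), left_mem_Icc.2 hpq⟩ isCompact_Icc
    have hst : s < t := hsp.trans_le ht.1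
    suffices h : G.measure (Icc s t) ≤ H.measure (Icc s t) from
      (pathMatching_le hst h).trans (EReal.coe_le_coe_iff.2 ht.2)
    rw [measure_Icc_le_iff_sub_leftLim G H hst.le]
    refine le_of_forall_pos_lt_add fun ε hε => ?_
    obtain ⟨n, hn⟩ := exists_nat_one_div_lt hε
    obtain ⟨r, h1, h2, h3⟩ := hp n
    have hr : (r : ℝ) ∈ Icc (p : ℝ) q := ⟨by exact_mod_cast h1, by exact_mod_cast h2⟩
    rw [hlt r (hsp.le.trans hr.1)] at h3
    have h4 : G t - H t ≤ G r - H r := hmin hr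
    linarith
  · refine le_sInf ?_
    rintro _ ⟨t, ⟨hst, ht⟩, rfl⟩
    rw [measure_Icc_le_iff_sub_leftLim G H hst.le] at ht
    refine le_of_forall_gt fun (z : EReal) hz => ?_
    obtain ⟨q, htq, hqz⟩ := EReal.lt_iff_exists_rat_btwn.1 hz
    have htq' : t < (q : ℝ) := EReal.coe_lt_coe_iff.1 htq
    refine lt_of_le_of_lt (iInf_le _ q) ?_
    rw [if_pos]
    · exact_mod_cast hqz
    obtain ⟨p, hsp, hpt⟩ := exists_rat_btwn hst
    refine ⟨p, hsp, fun n => ?_⟩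
    have h0 : 0 < 1 / ((n : ℝ) + 1) := Nat.one_div_pos_of_nat
    have hev : ∀ᶠ u in 𝓝[≥] t, G u < G t + 1 / ((n : ℝ) + 1) :=
      (G.right_continuous t).eventually (gt_mem_nhds (by linarith))
    obtain ⟨u, hu, hsub⟩ := (mem_nhdsGE_iff_exists_Ico_subset).1 hev
    obtain ⟨r, htr, hru⟩ := exists_rat_btwn (lt_min (show t < u from hu) htq')
    refine ⟨r, by exact_mod_cast (hpt.trans htr).le,
      by exact_mod_cast (hru.trans_le (min_le_right _ _)).le, ?_⟩
    rw [hlt r (hst.trans htr).le]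
    have h1 : G r < G t + 1 / ((n : ℝ) + 1) := hsub ⟨htr.le, hru.trans_le (min_le_left _ _)⟩
    have h2 := H.mono htr.le
    linarith

end Image

open Classical in
/-- A jointly measurable version of the matching of two s-finite kernels. -/
lemma exists_measurable_pathMatching {Ω : Type*} [MeasurableSpace Ω] (ξ η : Kernel Ω ℝ)
    [IsSFiniteKernel ξ] [IsSFiniteKernel η] :
    ∃ g : Ω × ℝ → EReal, Measurable g ∧ ∀ ω, IsLocallyFiniteMeasure (ξ ω) →
      IsLocallyFiniteMeasure (η ω) → (∀ x, ξ ω {x} = 0) →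
      ∀ s, pathMatching (ξ ω) (η ω) s = g (ω, s) := by
  refine ⟨fun p => ⨅ q : ℚ, if ReturnsBefore (ξ p.1) (η p.1) p.2 q then (((q : ℝ) : EReal))
    else ⊤, ?_, fun ω h1 h2 hdiff s => pathMatching_eq_iInf hdiff s⟩
  have hIcc : ∀ (κ : Kernel Ω ℝ) [IsSFiniteKernel κ] (r : ℝ),
      Measurable fun p : Ω × ℝ => κ p.1 (Icc p.2 r) := by
    intro κ _ r
    have hset : MeasurableSet {z : (Ω × ℝ) × ℝ | z.1.2 ≤ z.2 ∧ z.2 ≤ r} := by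
      have h1 : MeasurableSet {z : (Ω × ℝ) × ℝ | z.1.2 ≤ z.2} :=
        measurableSet_le (by fun_prop) (by fun_prop)
      have h2 : MeasurableSet {z : (Ω × ℝ) × ℝ | z.2 ≤ r} :=
        measurableSet_le (by fun_prop) (by fun_prop)
      exact h1.inter h2
    exact Kernel.measurable_kernel_prodMk_left (κ := κ.prodMkRight ℝ) hset
  refine Measurable.iInf fun q => Measurable.ite ?_ measurable_const measurable_const
  unfold ReturnsBefore
  simp only [ofPred_exists, ofPred_and, ofPred_forall]
  refine MeasurableSet.iUnion fun p => MeasurableSet.inter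
    (measurableSet_lt measurable_snd measurable_const) (MeasurableSet.iInter fun n =>
      MeasurableSet.iUnion fun r => ?_)
  refine MeasurableSet.inter (MeasurableSet.const _)
    (MeasurableSet.inter (MeasurableSet.const _) ?_)
  exact measurableSet_lt (hIcc ξ r) ((hIcc η r).add measurable_const)

/-! ### Equivariance of the matching -/

lemma pathMatching_shift {μ ν μ' ν' : Measure ℝ} {t : ℝ}
    (hμ : ∀ C, MeasurableSet C → μ' {x | x + t ∈ C} = μ C)
    (hν : ∀ C, MeasurableSet C → ν' {x | x + t ∈ C} = ν C) (s : ℝ) :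
    pathMatching μ' ν' (s - t) = pathMatching μ ν s - t := by
  have hset : ∀ r, {x | x + t ∈ Icc s r} = Icc (s - t) (r - t) := fun r => by
    ext x
    simp only [mem_ofPred_eq, mem_Icc, sub_le_iff_le_add, le_sub_iff_add_le]
  have hiff : ∀ r, (μ' (Icc (s - t) (r - t)) ≤ ν' (Icc (s - t) (r - t)) ↔
      μ (Icc s r) ≤ ν (Icc s r)) := fun r => by
    rw [← hset, hμ _ measurableSet_Icc, hν _ measurableSet_Icc]
  refine eq_of_forall_le_iff fun z => ?_
  rw [EReal.le_sub_iff_add_le (Or.inl (EReal.coe_ne_bot t)) (Or.inl (EReal.coe_ne_top t))]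
  simp only [pathMatching, le_sInf_iff, forall_mem_image]
  constructor
  · intro h r hr
    have := h (x := r - t) ⟨sub_lt_sub_right hr.1 t, (hiff r).2 hr.2⟩
    rwa [EReal.coe_sub, EReal.le_sub_iff_add_le (Or.inl (EReal.coe_ne_bot t))
      (Or.inl (EReal.coe_ne_top t))] at this
  · intro h r hr
    have h1 := (hiff (r + t)).1 (by rw [add_sub_cancel_right]; exact hr.2)
    have := h (x := r + t) ⟨by linarith [hr.1], h1⟩
    rwa [← EReal.le_sub_iff_add_le (Or.inl (EReal.coe_ne_bot t)) (Or.inl (EReal.coe_ne_top t)),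
      ← EReal.coe_sub, add_sub_cancel_right] at this

lemma exists_sub_coe_eq_iff {C : Set ℝ} {z : EReal} {t : ℝ} :
    (∃ x ∈ C, z - t = (x : EReal)) ↔ ∃ x, x - t ∈ C ∧ z = (x : EReal) := by
  induction z with
  | bot => simp [EReal.bot_sub, EReal.bot_ne_coe]
  | top => simp [EReal.top_ne_coe]
  | coe y =>
    simp only [← EReal.coe_sub, EReal.coe_eq_coe_iff]
    simp

variable {Ω : Type*} [MeasurableSpace Ω]

/-! ### Stationarity and ergodicity -/

/-- Ergodicity for events which are invariant up to null sets depending on the shift. -/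
lemma measure_eq_zero_or_compl {P : Measure Ω} [SFinite P] {θ : ℝ → Ω → Ω}
    (hθ : IsMeasurableFlow θ) (herg : IsErgodic P θ) {A : Set Ω} (hA : MeasurableSet A)
    (hinv : ∀ t, ∀ᵐ ω ∂P, θ t ω ∈ A ↔ ω ∈ A) : P A = 0 ∨ P Aᶜ = 0 := by
  -- The set of `ω` whose orbit is in `A` for Lebesgue-almost all times is strictly invariant.
  set A' : Set Ω := {ω | volume {t : ℝ | θ t ω ∉ A} = 0} with hA'
  have hjoint : MeasurableSet {p : Ω × ℝ | θ p.2 p.1 ∈ A} := hθ.measurable hA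
  have hA'm : MeasurableSet A' := by
    have h1 : Measurable fun ω => volume (Prod.mk ω ⁻¹' {p : Ω × ℝ | θ p.2 p.1 ∈ A}ᶜ) :=
      measurable_measure_prodMk_left hjoint.compl
    exact h1 (measurableSet_singleton 0)
  have hA'inv : ∀ s, θ s ⁻¹' A' = A' := by
    intro s
    ext ω
    have h1 : {t : ℝ | θ t (θ s ω) ∉ A} = (fun t => t + s) ⁻¹' {t : ℝ | θ t ω ∉ A} := by
      ext t
      simp only [mem_ofPred_eq, mem_preimage, hθ.comp]
    change volume {t : ℝ | θ t (θ s ω) ∉ A} = 0 ↔ volume {t : ℝ | θ t ω ∉ A} = 0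
    rw [h1, measure_preimage_add_right]
  have hcomm : ∀ᵐ ω ∂P, ∀ᵐ t ∂(volume : Measure ℝ), (θ t ω ∈ A ↔ ω ∈ A) := by
    refine (Measure.ae_ae_comm ?_).2 (ae_of_all _ hinv)
    have h2 : MeasurableSet {p : Ω × ℝ | p.1 ∈ A} := measurable_fst hA
    exact hjoint.iff h2
  have hAA' : A =ᵐ[P] A' := by
    filter_upwards [hcomm] with ω hω
    refine propext ⟨fun h => ?_, fun h => ?_⟩
    · have : ∀ᵐ t ∂(volume : Measure ℝ), θ t ω ∈ A := hω.mono fun t ht => ht.2 h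
      exact this
    · have h' : ∀ᵐ t ∂(volume : Measure ℝ), θ t ω ∈ A := h
      obtain ⟨t, h1, h2⟩ := (hω.and h').exists
      exact h1.1 h2
  rw [measure_congr hAA', measure_congr hAA'.compl]
  exact herg A' hA'm hA'inv

/-- The mass transport principle along the integers: if `H j k` is the mass sent from cell `j` to
cell `k` in a stationary way, then the expected mass leaving cell `0` is the expected mass
arriving there. -/
lemma tsum_lintegral_transport {P : Measure Ω} {θ : ℝ → Ω → Ω} (hstat : IsStationary P θ)
    (H : ℤ → ℤ → Ω → ℝ≥0∞) (hH : ∀ j k, Measurable (H j k))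
    (hinv : ∀ n j k : ℤ, ∀ᵐ ω ∂P, H j k (θ n ω) = H (j + n) (k + n) ω) :
    ∑' k, ∫⁻ ω, H 0 k ω ∂P = ∑' j, ∫⁻ ω, H j 0 ω ∂P := by
  have h1 : ∀ k, ∫⁻ ω, H 0 k ω ∂P = ∫⁻ ω, H (-k) 0 ω ∂P := by
    intro k
    rw [← (hstat ((-k : ℤ) : ℝ)).lintegral_comp (hH 0 k)]
    refine lintegral_congr_ae ?_
    filter_upwards [hinv (-k) 0 k] with ω hω
    rw [hω, zero_add, add_neg_cancel]
  simp_rw [h1]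
  exact (Equiv.neg ℤ).tsum_eq fun j => ∫⁻ ω, H j 0 ω ∂P

/-- Invariance of a random measure at each fixed shift, almost surely. -/
def IsShiftCovariant (P : Measure Ω) (θ : ℝ → Ω → Ω) (κ : Kernel Ω ℝ) : Prop :=
  ∀ t, ∀ᵐ ω ∂P, ∀ C, MeasurableSet C → κ (θ t ω) C = κ ω {x | x - t ∈ C}

lemma sub_mem_Ioc_iff (a b t x : ℝ) : x - t ∈ Ioc a b ↔ x ∈ Ioc (a + t) (b + t) := by
  simp only [mem_Ioc, lt_sub_iff_add_lt, sub_le_iff_le_add]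

lemma tsum_measure_inter_Ioc_intCast (μ : Measure ℝ) {S : Set ℝ} (hS : MeasurableSet S) :
    ∑' j : ℤ, μ (S ∩ Ioc (j : ℝ) (j + 1)) = μ S := by
  rw [← measure_iUnion _ fun j => hS.inter measurableSet_Ioc, ← inter_iUnion,
    iUnion_Ioc_intCast, inter_univ]
  exact fun m n hmn =>
    (pairwise_disjoint_Ioc_intCast ℝ hmn).mono inter_subset_right inter_subset_right

/-- A stationary random measure with finite intensity and infinite total mass does not allow a
random cell to be singled out: sending the whole mass to that cell would make infinitely much
mass arrive there. -/
lemma measure_cell_eq_zero {P : Measure Ω} {θ : ℝ → Ω → Ω} (hstat : IsStationary P θ)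
    {ζ : Kernel Ω ℝ} (hζ : IsShiftCovariant P θ ζ) (hfin : ∫⁻ ω, ζ ω (Ioc 0 1) ∂P ≠ ∞)
    {E : ℤ → Set Ω} (hE : ∀ k, MeasurableSet (E k))
    (hEinv : ∀ n k : ℤ, ∀ᵐ ω ∂P, θ n ω ∈ E k ↔ ω ∈ E (k + n))
    (hdisj : Pairwise (Function.onFun Disjoint E))
    (htop : ∀ᵐ ω ∂P, ω ∈ E 0 → ζ ω univ = ∞) (k : ℤ) : P (E k) = 0 := by
  suffices h0 : P (E 0) = 0 by
    have h1 : ∀ᵐ ω ∂P, ω ∉ E 0 := measure_eq_zero_iff_ae_notMem.1 h0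
    have h2 := (hstat (k : ℝ)).quasiMeasurePreserving.ae h1
    rw [measure_eq_zero_iff_ae_notMem]
    filter_upwards [h2, hEinv k 0] with ω h3 h4
    rwa [h4, zero_add] at h3
  have hm : ∀ j k : ℤ, Measurable ((E k).indicator fun ω => ζ ω (Ioc (j : ℝ) (j + 1))) :=
    fun j k => (Kernel.measurable_coe ζ measurableSet_Ioc).indicator (hE k)
  have key := tsum_lintegral_transport hstat
    (fun j k => (E k).indicator fun ω => ζ ω (Ioc (j : ℝ) (j + 1))) hm (by
      intro n j k
      filter_upwards [hζ n, hEinv n k] with ω h1 h2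
      have h3 : ζ (θ n ω) (Ioc (j : ℝ) (j + 1)) =
          ζ ω (Ioc ((j + n : ℤ) : ℝ) ((j + n : ℤ) + 1)) := by
        rw [h1 _ measurableSet_Ioc, Int.cast_add, add_right_comm]
        simp only [sub_mem_Ioc_iff, ofPred_mem_eq]
      classical
      rw [indicator_apply, indicator_apply, h3]
      exact if_congr h2 rfl rfl)
  have hleft : ∑' k, ∫⁻ ω, (E k).indicator (fun ω => ζ ω (Ioc ((0 : ℤ) : ℝ) ((0 : ℤ) + 1))) ω ∂P ≤
      ∫⁻ ω, ζ ω (Ioc 0 1) ∂P := by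
    simp_rw [lintegral_indicator (hE _), Int.cast_zero, zero_add]
    rw [← lintegral_iUnion hE hdisj]
    exact setLIntegral_le_lintegral _ _
  have hright : ∑' j : ℤ, ∫⁻ ω, (E 0).indicator (fun ω => ζ ω (Ioc (j : ℝ) (j + 1))) ω ∂P =
      ∫⁻ ω in E 0, ζ ω univ ∂P := by
    simp_rw [lintegral_indicator (hE _)]
    rw [← lintegral_tsum fun j => (Kernel.measurable_coe ζ measurableSet_Ioc).aemeasurable]
    refine lintegral_congr fun ω => ?_
    simpa using tsum_measure_inter_Ioc_intCast (ζ ω) MeasurableSet.univ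
  rw [hright] at key
  have hlt : ∫⁻ ω in E 0, ζ ω univ ∂P ≠ ∞ := by
    rw [← key]
    exact (hleft.trans_lt (lt_top_iff_ne_top.2 hfin)).ne
  have h5 := ae_lt_top (Kernel.measurable_coe ζ MeasurableSet.univ) hlt
  rw [ae_restrict_iff' (hE 0)] at h5
  rw [measure_eq_zero_iff_ae_notMem]
  filter_upwards [h5, htop] with ω h6 h7 h8
  exact (h6 h8).ne (h7 h8)

/-- Poincaré recurrence for an equivariant random set `B`: if `B` carries mass of `ξ` at all, it
carries mass arbitrarily far to the left. For infinite `P` the random measure `ξ` itself replaces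
the Lebesgue measure in excluding a random leftmost cell. -/
lemma measure_inter_Iic_ne_zero {P : Measure Ω} {θ : ℝ → Ω → Ω} (hstat : IsStationary P θ)
    {ξ : Kernel Ω ℝ} [IsSFiniteKernel ξ] (hξ : IsShiftCovariant P θ ξ)
    (hfin : ∫⁻ ω, ξ ω (Ioc 0 1) ∂P ≠ ∞)
    (hrec : P univ = ∞ → ∀ᵐ ω ∂P, ξ ω univ = 0 ∨ ξ ω univ = ∞)
    {B : Set (Ω × ℝ)} (hB : MeasurableSet B)
    (hBinv : ∀ t, ∀ᵐ ω ∂P, ∀ s, (θ t ω, s - t) ∈ B ↔ (ω, s) ∈ B) :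
    ∀ᵐ ω ∂P, ξ ω {s | (ω, s) ∈ B} ≠ 0 → ∀ k : ℤ, ξ ω {s | (ω, s) ∈ B ∧ s ≤ k} ≠ 0 := by
  set D : ℤ → Set Ω := fun k => {ω | ξ ω {s | (ω, s) ∈ B ∧ s ≤ k} = 0} with hD
  have hBk : ∀ k : ℤ, MeasurableSet {p : Ω × ℝ | p ∈ B ∧ p.2 ≤ k} := fun k =>
    hB.inter (measurable_snd measurableSet_Iic)
  have hDm : ∀ k, MeasurableSet (D k) := fun k =>
    (Kernel.measurable_kernel_prodMk_left (κ := ξ) (hBk k)) (measurableSet_singleton 0)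
  have hDinv : ∀ n k : ℤ, ∀ᵐ ω ∂P, θ n ω ∈ D k ↔ ω ∈ D (k + n) := by
    intro n k
    filter_upwards [hξ n, hBinv n] with ω h1 h2
    change ξ (θ n ω) {s | (θ n ω, s) ∈ B ∧ s ≤ k} = 0 ↔
      ξ ω {s | (ω, s) ∈ B ∧ s ≤ ((k + n : ℤ) : ℝ)} = 0
    have h3 : MeasurableSet {s | (θ n ω, s) ∈ B ∧ s ≤ k} := measurable_prodMk_left (hBk k)
    rw [h1 _ h3]
    simp only [mem_ofPred_eq, h2, sub_le_iff_le_add, Int.cast_add]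
  have hanti : ∀ k l, k ≤ l → D l ⊆ D k := by
    intro k l hkl ω hω
    have hsub : {s | (ω, s) ∈ B ∧ s ≤ (k : ℝ)} ⊆ {s | (ω, s) ∈ B ∧ s ≤ (l : ℝ)} :=
      fun s hs => ⟨hs.1, hs.2.trans (Int.cast_le.2 hkl)⟩
    exact measure_mono_null hsub hω
  set E : ℤ → Set Ω := fun k => D k \ D (k + 1) with hE
  have hEm : ∀ k, MeasurableSet (E k) := fun k => (hDm k).diff (hDm (k + 1))
  have hEinv : ∀ n k : ℤ, ∀ᵐ ω ∂P, θ n ω ∈ E k ↔ ω ∈ E (k + n) := by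
    intro n k
    filter_upwards [hDinv n k, hDinv n (k + 1)] with ω h1 h2
    change (θ n ω ∈ D k ∧ ¬ θ n ω ∈ D (k + 1)) ↔ (ω ∈ D (k + n) ∧ ¬ ω ∈ D (k + n + 1))
    rw [h1, h2, add_right_comm]
  have hEdisj : Pairwise (Function.onFun Disjoint E) := by
    have hlt : ∀ m n, m < n → Disjoint (E m) (E n) := fun m n hmn =>
      disjoint_left.2 fun ω h1 h2 => h1.2 (hanti (m + 1) n hmn h2.1)
    intro m n hmn
    rcases hmn.lt_or_gt with h | h
    · exact hlt m n h
    · exact (hlt n m h).symm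
  have hEmass : ∀ ω ∈ E 0, ξ ω univ ≠ 0 := fun ω hω h =>
    hω.2 (measure_mono_null (subset_univ _) h)
  have hPE : ∀ k, P (E k) = 0 := by
    by_cases hP : P univ = ∞
    · refine measure_cell_eq_zero hstat hξ hfin hEm hEinv hEdisj ?_
      filter_upwards [hrec hP] with ω h1 h2
      exact h1.resolve_left (hEmass ω h2)
    · refine measure_cell_eq_zero hstat (ζ := Kernel.const Ω (volume : Measure ℝ)) ?_ ?_ hEm hEinv
        hEdisj (ae_of_all _ fun ω _ => by simp)
      · refine fun t => ae_of_all _ fun ω C _ => ?_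
        rw [Kernel.const_apply, Kernel.const_apply]
        have h1 := measure_preimage_add_right (volume : Measure ℝ) (-t) C
        simp only [← sub_eq_add_neg] at h1
        exact h1.symm
      · simpa using hP
  have hPE' : ∀ᵐ ω ∂P, ∀ k, ω ∉ E k :=
    ae_all_iff.2 fun k => measure_eq_zero_iff_ae_notMem.1 (hPE k)
  filter_upwards [hPE'] with ω hω hne k hk
  -- If the mass of `B` up to `k` vanishes, then so does the mass up to every later integer.
  have hstep : ∀ n : ℕ, ω ∈ D (k + n) := by
    intro n
    induction n with
    | zero => rwa [Nat.cast_zero, add_zero]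
    | succ n ih =>
      by_contra h
      refine hω (k + n) ⟨ih, ?_⟩
      rwa [Nat.cast_succ, ← add_assoc] at h
  refine hne (measure_mono_null ?_ (measure_iUnion_null hstep))
  intro s hs
  obtain ⟨n, hn⟩ := exists_nat_ge (s - k)
  refine mem_iUnion.2 ⟨n, hs, ?_⟩
  push_cast
  linarith

/-- An equivariant map transports mass in a stationary way, so the intensity of the image is the
intensity of the mass which is sent to the real line. -/
lemma lintegral_transport {P : Measure Ω} {θ : ℝ → Ω → Ω} (hstat : IsStationary P θ)
    {ξ : Kernel Ω ℝ} [IsSFiniteKernel ξ] (hξ : IsShiftCovariant P θ ξ)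
    {g : Ω × ℝ → EReal} (hg : Measurable g)
    (hginv : ∀ t : ℝ, ∀ᵐ ω ∂P, ∀ s, g (θ t ω, s - t) = g (ω, s) - t) :
    ∫⁻ ω, ξ ω {s | s ∈ Ioc 0 1 ∧ ∃ x : ℝ, g (ω, s) = x} ∂P =
      ∫⁻ ω, ξ ω {s | ∃ x ∈ Ioc (0 : ℝ) 1, g (ω, s) = (x : EReal)} ∂P := by
  have hset : ∀ C : Set ℝ, MeasurableSet C →
      MeasurableSet {p : Ω × ℝ | ∃ x ∈ C, g p = (x : EReal)} := by
    intro C hC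
    have h1 : {p : Ω × ℝ | ∃ x ∈ C, g p = (x : EReal)} = g ⁻¹' (Real.toEReal '' C) := by
      ext p
      simp only [mem_preimage, mem_image, mem_ofPred_eq, eq_comm]
    rw [h1]
    exact hg (EReal.measurableEmbedding_coe.measurableSet_image' hC)
  have hcell : ∀ j k : ℤ, MeasurableSet {p : Ω × ℝ | p.2 ∈ Ioc (j : ℝ) (j + 1) ∧
      ∃ x ∈ Ioc (k : ℝ) (k + 1), g p = (x : EReal)} := fun j k =>
    (measurable_snd measurableSet_Ioc).inter (hset _ measurableSet_Ioc)
  have hm : ∀ j k : ℤ, Measurable fun ω => ξ ω {s | s ∈ Ioc (j : ℝ) (j + 1) ∧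
      ∃ x ∈ Ioc (k : ℝ) (k + 1), g (ω, s) = (x : EReal)} := fun j k =>
    Kernel.measurable_kernel_prodMk_left (κ := ξ) (hcell j k)
  have key := tsum_lintegral_transport hstat _ hm (by
    intro n j k
    filter_upwards [hξ n, hginv n] with ω h1 h2
    have h3 : MeasurableSet {s | s ∈ Ioc (j : ℝ) (j + 1) ∧
      ∃ x ∈ Ioc (k : ℝ) (k + 1), g (θ n ω, s) = (x : EReal)} := measurable_prodMk_left (hcell j k)
    rw [h1 _ h3]
    congr 1
    ext s
    simp only [mem_ofPred_eq, h2, exists_sub_coe_eq_iff, sub_mem_Ioc_iff, Int.cast_add,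
      add_right_comm])
  rw [← lintegral_tsum fun k => (hm 0 k).aemeasurable,
    ← lintegral_tsum fun j => (hm j 0).aemeasurable] at key
  convert key using 1
  · refine lintegral_congr fun ω => ?_
    rw [← measure_iUnion]
    · congr 1
      ext s
      simp only [mem_iUnion, mem_ofPred_eq, Int.cast_zero, zero_add]
      constructor
      · rintro ⟨h1, x, hx⟩
        obtain ⟨k, hk⟩ := mem_iUnion.1 ((iUnion_Ioc_intCast ℝ).symm ▸ mem_univ x)
        exact ⟨k, h1, x, hk, hx⟩
      · rintro ⟨k, h1, x, -, hx⟩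
        exact ⟨h1, x, hx⟩
    · intro k l hkl
      refine disjoint_left.2 ?_
      rintro s ⟨-, x, hx, h1⟩ ⟨-, y, hy, h2⟩
      rw [h1, EReal.coe_eq_coe_iff] at h2
      exact disjoint_left.1 (pairwise_disjoint_Ioc_intCast ℝ hkl) hx (h2 ▸ hy)
    · exact fun k => measurable_prodMk_left (hcell 0 k)
  · refine lintegral_congr fun ω => ?_
    have h1 : MeasurableSet {s | ∃ x ∈ Ioc (0 : ℝ) 1, g (ω, s) = (x : EReal)} :=
      measurable_prodMk_left (hset _ measurableSet_Ioc)
    rw [← tsum_measure_inter_Ioc_intCast _ h1]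
    refine tsum_congr fun j => ?_
    congr 1
    ext s
    simp only [mem_inter_iff, mem_ofPred_eq, Int.cast_zero, zero_add, and_comm]

/-- A stationary random measure of finite intensity has no fixed atoms. -/
lemma lintegral_singleton_zero {P : Measure Ω} {θ : ℝ → Ω → Ω} (hstat : IsStationary P θ)
    {η : Kernel Ω ℝ} (hη : IsShiftCovariant P θ η) (hfin : intensity P η ≠ ∞) :
    ∫⁻ ω, η ω {0} ∂P = 0 := by
  have h1 : ∀ x : ℝ, ∫⁻ ω, η ω {x} ∂P = ∫⁻ ω, η ω {0} ∂P := by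
    intro x
    rw [← (hstat x).lintegral_comp (Kernel.measurable_coe η (measurableSet_singleton 0))]
    refine lintegral_congr_ae ?_
    filter_upwards [hη x] with ω h
    rw [h _ (measurableSet_singleton 0)]
    congr 1
    ext y
    simp [sub_eq_zero]
  by_contra hne
  refine hfin (top_le_iff.1 ?_)
  calc (∞ : ℝ≥0∞) = ∑' _ : ℕ, ∫⁻ ω, η ω {0} ∂P :=
        (ENNReal.tsum_const_eq_top_of_ne_zero hne).symm
    _ = ∑' n : ℕ, ∫⁻ ω, η ω {1 / ((n : ℝ) + 1)} ∂P := by simp_rw [h1]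
    _ = ∫⁻ ω, ∑' n : ℕ, η ω {1 / ((n : ℝ) + 1)} ∂P :=
        (lintegral_tsum fun n =>
          (Kernel.measurable_coe η (measurableSet_singleton _)).aemeasurable).symm
    _ ≤ intensity P η := by
        refine lintegral_mono fun ω => ?_
        rw [← measure_iUnion _ fun n => measurableSet_singleton _]
        · refine measure_mono (iUnion_subset fun n => ?_)
          rw [singleton_subset_iff]
          have h0 : (0 : ℝ) < n + 1 := n.cast_add_one_pos
          exact ⟨by positivity, (div_le_one h0).2 (by linarith [n.cast_nonneg (α := ℝ)])⟩
        · intro m n hmn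
          rw [Function.onFun, disjoint_singleton]
          intro h
          rw [one_div, one_div, inv_inj, add_left_inj, Nat.cast_inj] at h
          exact hmn h

/-! ### Kernels that are locally finite almost everywhere -/

/-- Every kernel agrees with an s-finite kernel at all parameters for which it is locally
finite. -/
lemma exists_sFinite_kernel (κ : Kernel Ω ℝ) : ∃ κ' : Kernel Ω ℝ, IsSFiniteKernel κ' ∧
    ∀ ω, (∀ C, IsCompact C → κ ω C < ∞) → κ' ω = κ ω := by
  classical
  -- The piece of mass in the cell `(m, m + 1]`, for those `ω` where it is in `[k, k + 1)`.
  have hS : ∀ p : ℤ × ℕ, MeasurableSet {ω | ⌊(κ ω (Ioc (p.1 : ℝ) (p.1 + 1))).toReal⌋₊ = p.2 ∧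
      κ ω (Ioc (p.1 : ℝ) (p.1 + 1)) ≠ ∞} := by
    intro p
    have h1 : Measurable fun ω => κ ω (Ioc (p.1 : ℝ) (p.1 + 1)) :=
      Kernel.measurable_coe κ measurableSet_Ioc
    exact ((Nat.measurable_floor.comp h1.ennreal_toReal) (measurableSet_singleton p.2)).inter
      (h1 (measurableSet_singleton ∞).compl)
  let piece : ℤ × ℕ → Kernel Ω ℝ := fun p => Kernel.piecewise (hS p)
    (κ.restrict (measurableSet_Ioc (a := (p.1 : ℝ)) (b := p.1 + 1))) 0
  have hfin : ∀ p, IsFiniteKernel (piece p) := by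
    refine fun p => ⟨(p.2 : ℝ≥0∞) + 1, by simp, fun ω => ?_⟩
    rw [Kernel.piecewise_apply]
    split_ifs with h
    · rw [Kernel.restrict_apply, Measure.restrict_apply_univ, ← ENNReal.ofReal_toReal h.2]
      refine (ENNReal.ofReal_le_ofReal (Nat.lt_floor_add_one _).le).trans ?_
      rw [h.1, ENNReal.ofReal_add (by positivity) (by positivity)]
      simp
    · simp
  refine ⟨Kernel.sum piece, Kernel.isSFiniteKernel_sum (hκs := fun p => inferInstance),
    fun ω hω => ?_⟩
  have hcell : ∀ m : ℤ, κ ω (Ioc (m : ℝ) (m + 1)) ≠ ∞ := fun m =>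
    ((measure_mono Ioc_subset_Icc_self).trans_lt (hω _ isCompact_Icc)).ne
  ext C hC
  rw [Kernel.sum_apply' _ _ hC, ENNReal.tsum_prod', ← tsum_measure_inter_Ioc_intCast (κ ω) hC]
  refine tsum_congr fun m => ?_
  rw [tsum_eq_single ⌊(κ ω (Ioc (m : ℝ) (m + 1))).toReal⌋₊]
  · simp only [piece, Kernel.piecewise_apply]
    rw [if_pos ⟨rfl, hcell m⟩, Kernel.restrict_apply, Measure.restrict_apply hC]
  · intro k hk
    simp only [piece, Kernel.piecewise_apply]
    rw [if_neg fun h => hk h.1.symm]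
    simp

/-! ### Balancing -/

/-- The joint version `g` of the matching of two s-finite kernels leaves no mass of `ξ`
unmatched, and it transports `ξ` to `η`. -/
theorem ae_balances {P : Measure Ω} [SigmaFinite P]
    {θ : ℝ → Ω → Ω} (hθ : IsMeasurableFlow θ) (hstat : IsStationary P θ) (herg : IsErgodic P θ)
    {ξ η : Kernel Ω ℝ} [IsSFiniteKernel ξ]
    (hξ : ∀ᵐ ω ∂P, IsLocallyFiniteMeasure (ξ ω)) (hη : ∀ᵐ ω ∂P, IsLocallyFiniteMeasure (η ω))
    (hξinv : IsShiftCovariant P θ ξ) (hηinv : IsShiftCovariant P θ η)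
    (hsing : AreMutuallySingular P ξ η) (hdiff : IsDiffuse P ξ)
    (hfin : intensity P ξ < ∞) (hint : intensity P ξ = intensity P η)
    (hrec : P univ = ∞ → ∀ᵐ ω ∂P, ξ ω univ = 0 ∨ ξ ω univ = ∞)
    {g : Ω × ℝ → EReal} (hg : Measurable g)
    (hgm : ∀ᵐ ω ∂P, ∀ s, pathMatching (ξ ω) (η ω) s = g (ω, s))
    (hginv : ∀ t : ℝ, ∀ᵐ ω ∂P, ∀ s, g (θ t ω, s - t) = g (ω, s) - t) :
    (∀ᵐ ω ∂P, ξ ω {s | g (ω, s) = ⊤} = 0) ∧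
      ∀ᵐ ω ∂P, ∀ C : Set ℝ, MeasurableSet C →
        ξ ω {s | ∃ x ∈ C, g (ω, s) = (x : EReal)} = η ω C := by
  set τ : Ω → ℝ → EReal := fun ω s => g (ω, s) with hτ
  have hτm : ∀ ω, Measurable (τ ω) := fun ω => hg.comp measurable_prodMk_left
  have hτeq : ∀ᵐ ω ∂P, pathMatching (ξ ω) (η ω) = τ ω := hgm.mono fun ω h => funext h
  have hreal : ∀ᵐ ω ∂P, ∀ s, (∃ x : ℝ, τ ω s = x) ↔ τ ω s ≠ ⊤ := by
    filter_upwards [hτeq] with ω h s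
    constructor
    · rintro ⟨x, hx⟩
      rw [hx]
      exact EReal.coe_ne_top x
    · intro h1
      have h2 : τ ω s ≠ ⊥ := by
        rw [← h]
        exact ((EReal.bot_lt_coe s).trans_le (le_pathMatching _ _ s)).ne'
      exact ⟨(τ ω s).toReal, (EReal.coe_toReal h1 h2).symm⟩
  have hle : ∀ᵐ ω ∂P, realImage (ξ ω) (τ ω) ≤ η ω := by
    filter_upwards [hξ, hη, hdiff, hsing, hτeq] with ω h1 h2 h3 h4 h5
    rw [← h5]
    exact realImage_pathMatching_le h3 h4 (h5 ▸ hτm ω)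
  -- All the intensities which occur are equal on the half-open unit interval.
  have hξ01 : ∫⁻ ω, ξ ω (Ioc 0 1) ∂P = intensity P ξ := by
    refine lintegral_congr_ae ?_
    filter_upwards [hdiff] with ω h
    refine le_antisymm (measure_mono Ioc_subset_Icc_self) ?_
    rw [← Ioc_insert_left zero_le_one, insert_eq]
    refine (measure_union_le _ _).trans ?_
    rw [h, zero_add]
  have hη01 : ∫⁻ ω, η ω (Ioc 0 1) ∂P = intensity P ξ := by
    rw [hint]
    refine le_antisymm (lintegral_mono fun ω => measure_mono Ioc_subset_Icc_self) ?_
    have h0 := lintegral_singleton_zero hstat hηinv (hint ▸ hfin.ne)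
    calc intensity P η ≤ ∫⁻ ω, (η ω {0} + η ω (Ioc 0 1)) ∂P := by
          refine lintegral_mono fun ω => ?_
          rw [← Ioc_insert_left zero_le_one, insert_eq]
          exact measure_union_le _ _
      _ = ∫⁻ ω, η ω (Ioc 0 1) ∂P := by
          rw [lintegral_add_left (Kernel.measurable_coe η (measurableSet_singleton 0)), h0,
            zero_add]
  have hmatched : ∫⁻ ω, ξ ω (Ioc 0 1 \ {s | τ ω s = ⊤}) ∂P =
      ∫⁻ ω, realImage (ξ ω) (τ ω) (Ioc 0 1) ∂P := by
    simp_rw [realImage_apply (hτm _) measurableSet_Ioc]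
    rw [← lintegral_transport hstat hξinv hg hginv]
    refine lintegral_congr_ae ?_
    filter_upwards [hreal] with ω h
    congr 1
    ext s
    exact and_congr_right fun _ => (h s).symm
  have htop : MeasurableSet {p : Ω × ℝ | g p = ⊤} := hg (measurableSet_singleton ⊤)
  have htopω : ∀ ω, MeasurableSet {s | τ ω s = ⊤} := fun ω => hτm ω (measurableSet_singleton ⊤)
  have htopinv : ∀ t, ∀ᵐ ω ∂P, ∀ s, τ (θ t ω) (s - t) = ⊤ ↔ τ ω s = ⊤ := by
    intro t
    filter_upwards [hginv t] with ω h s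
    change g (θ t ω, s - t) = ⊤ ↔ g (ω, s) = ⊤
    rw [h s]
    induction g (ω, s) with
    | bot => simp [EReal.bot_sub]
    | top => simp
    | coe y => simp [← EReal.coe_sub]
  have hdiffm : Measurable fun ω => ξ ω (Ioc 0 1 \ {s | τ ω s = ⊤}) :=
    Kernel.measurable_kernel_prodMk_left (κ := ξ)
      ((measurable_snd measurableSet_Ioc).diff htop)
  have hshift : ∀ {p : Ω → Prop}, (∀ᵐ ω ∂P, p ω) → ∀ᵐ ω ∂P, ∀ n : ℤ, p (θ n ω) := fun hp =>
    ae_all_iff.2 fun n => (hstat n).quasiMeasurePreserving.ae hp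
  have hall : ∀ {κ : Kernel Ω ℝ}, IsShiftCovariant P θ κ → ∀ᵐ ω ∂P, ∀ n : ℤ, ∀ C,
      MeasurableSet C → κ (θ n ω) C = κ ω {x | x - n ∈ C} := fun h => ae_all_iff.2 fun n => h n
  have hunit : ∀ (n : ℤ) (x : ℝ), x - n ∈ Ioc (0 : ℝ) 1 ↔ x ∈ Ioc (n : ℝ) (n + 1) := by
    intro n x
    rw [sub_mem_Ioc_iff, zero_add, add_comm]
  -- The set of `ω` for which some mass is unmatched has probability zero or one.
  set A : Set Ω := {ω | ξ ω {s | τ ω s = ⊤} ≠ 0} with hA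
  have hAm : MeasurableSet A :=
    (Kernel.measurable_kernel_prodMk_left (κ := ξ) htop) (measurableSet_singleton 0).compl
  have hAinv : ∀ t, ∀ᵐ ω ∂P, θ t ω ∈ A ↔ ω ∈ A := by
    intro t
    filter_upwards [hξinv t, htopinv t] with ω h1 h2
    change ξ (θ t ω) {s | τ (θ t ω) s = ⊤} ≠ 0 ↔ ξ ω {s | τ ω s = ⊤} ≠ 0
    rw [h1 _ (htopω _)]
    simp only [mem_ofPred_eq, h2]
  have hPA : P A = 0 := by
    refine (measure_eq_zero_or_compl hθ herg hAm hAinv).elim id fun hAc => ?_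
    -- If some mass is unmatched almost surely, then recurrence makes all of `η` used, so that
    -- the matched mass has the full intensity and nothing is left to be unmatched.
    have hmem : ∀ᵐ ω ∂P, ω ∈ A := by
      filter_upwards [measure_eq_zero_iff_ae_notMem.1 hAc] with ω h
      exact not_not.1 h
    have hleft := measure_inter_Iic_ne_zero hstat hξinv (hξ01 ▸ hfin.ne) hrec htop htopinv
    have hge : ∀ᵐ ω ∂P, η ω ≤ realImage (ξ ω) (τ ω) := by
      filter_upwards [hξ, hη, hdiff, hsing, hτeq, hmem, hleft] with ω h1 h2 h3 h4 h5 h6 h7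
      rw [← h5]
      refine le_realImage_pathMatching h3 h4 (h5 ▸ hτm ω) fun x => ?_
      have h8 := h7 h6 (⌈x⌉ - 1)
      -- An atom of `η` carries no mass of `ξ`, so a suitable point can be chosen off the atoms.
      by_contra! hcon
      refine h8 (measure_mono_null (t := {c | η ω {c} ≠ 0}) ?_ ?_)
      · intro c hc h9
        refine hcon c ?_ h9 ?_
        · have h10 : c ≤ ((⌈x⌉ - 1 : ℤ) : ℝ) := hc.2
          have h11 := Int.ceil_lt_add_one x
          push_cast at h10
          linarith
        · rw [h5]
          exact hc.1
      · have h9 : {c | η ω {c} ≠ 0}.Countable := by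
          have := Measure.countable_meas_pos_of_disjoint_iUnion (μ := η ω)
            (As := fun c : ℝ => {c}) (fun c => measurableSet_singleton c)
            (fun a b hab => disjoint_singleton.2 hab)
          simpa only [pos_iff_ne_zero] using this
        rw [← biUnion_of_singleton {c | η ω {c} ≠ 0}]
        exact (measure_biUnion_null_iff h9).2 fun c _ => h3 c
    have heq : (fun ω => ξ ω (Ioc 0 1 \ {s | τ ω s = ⊤})) =ᵐ[P] fun ω => ξ ω (Ioc 0 1) := by
      refine ae_eq_of_ae_le_of_lintegral_le (ae_of_all _ fun ω => measure_mono sdiff_subset) ?_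
        (Kernel.measurable_coe ξ measurableSet_Ioc).aemeasurable ?_
      · exact ((lintegral_mono fun ω => measure_mono sdiff_subset).trans_lt
          (hξ01 ▸ hfin)).ne
      · rw [hmatched, hξ01, ← hη01]
        exact lintegral_mono_ae (hge.mono fun ω h => h _)
    rw [measure_eq_zero_iff_ae_notMem]
    filter_upwards [hshift heq, hall hξinv, ae_all_iff.2 fun n : ℤ => htopinv n, hξ] with
      ω h1 h2 h3 h4 h5
    refine h5 ?_
    rw [← tsum_measure_inter_Ioc_intCast _ (htopω ω)]
    refine ENNReal.tsum_eq_zero.2 fun n => ?_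
    have h6 := h1 n
    rw [h2 n _ (measurableSet_Ioc.diff (htopω _)), h2 n _ measurableSet_Ioc] at h6
    have h7 : {x | x - (n : ℝ) ∈ Ioc 0 1 \ {s | τ (θ n ω) s = ⊤}} =
        Ioc (n : ℝ) (n + 1) \ {s | τ ω s = ⊤} := by
      ext x
      exact and_congr (hunit n x) (not_congr (h3 n x))
    have h8 : {x | x - (n : ℝ) ∈ Ioc 0 1} = Ioc (n : ℝ) (n + 1) := by
      ext x
      exact hunit n x
    rw [h7, h8] at h6
    have h9 := measure_inter_add_sdiff (μ := ξ ω) (Ioc (n : ℝ) (n + 1)) (htopω ω)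
    rw [h6, inter_comm] at h9
    exact (ENNReal.add_left_inj measure_Ioc_lt_top.ne).1 (h9.trans (zero_add _).symm)
  have hunmatched : ∀ᵐ ω ∂P, ξ ω {s | τ ω s = ⊤} = 0 := by
    filter_upwards [measure_eq_zero_iff_ae_notMem.1 hPA] with ω h
    exact not_not.1 h
  refine ⟨hunmatched, ?_⟩
  -- The image of `ξ` is below `η` and has the same intensity.
  have heq : (fun ω => realImage (ξ ω) (τ ω) (Ioc 0 1)) =ᵐ[P] fun ω => η ω (Ioc 0 1) := by
    refine ae_eq_of_ae_le_of_lintegral_le (hle.mono fun ω h => h _) ?_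
      (Kernel.measurable_coe η measurableSet_Ioc).aemeasurable ?_
    · exact ((lintegral_mono_ae (hle.mono fun ω h => h _)).trans_lt (hη01 ▸ hfin)).ne
    · rw [← hmatched, hη01, ← hξ01]
      refine lintegral_mono_ae (hunmatched.mono fun ω h => ?_)
      rw [measure_sdiff_null h]
  filter_upwards [hshift heq, hall hξinv, hall hηinv, ae_all_iff.2 fun n : ℤ => hginv n, hle, hη]
    with ω h1 h2 h3 h4 h5 h6 C hC
  rw [← eq_of_le_of_unit_intervals h5 fun n => ?_, realImage_apply (hτm ω) hC]
  have h7 := h1 n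
  have h8 : {x | x - (n : ℝ) ∈ Ioc 0 1} = Ioc (n : ℝ) (n + 1) := by
    ext x
    exact hunit n x
  have h9 : MeasurableSet {s | ∃ x ∈ Ioc (0 : ℝ) 1, τ (θ n ω) s = (x : EReal)} := by
    simp only [exists_eq_coe_mem_Ioc_iff]
    exact (measurableSet_lt measurable_const (hτm _)).inter
      (measurableSet_le (hτm _) measurable_const)
  rw [h3 n _ measurableSet_Ioc, h8, realImage_apply (hτm _) measurableSet_Ioc, h2 n _ h9] at h7
  rw [← h7, realImage_apply (hτm ω) measurableSet_Ioc]
  congr 1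
  ext s
  simp only [mem_ofPred_eq, hτ, h4, exists_sub_coe_eq_iff, hunit]

end RandomTransport

theorem theorem1p1 {Ω : Type*} [MeasurableSpace Ω] (P : Measure Ω) [SigmaFinite P]
    (θ : ℝ → Ω → Ω) (hθ : RandomTransport.IsMeasurableFlow θ)
    (hstat : RandomTransport.IsStationary P θ) (herg : RandomTransport.IsErgodic P θ)
    (ξ η : Kernel Ω ℝ)
    (hξ : RandomTransport.IsRandomMeasure P ξ) (hη : RandomTransport.IsRandomMeasure P η)
    (hξinv : RandomTransport.IsInvariant P θ ξ) (hηinv : RandomTransport.IsInvariant P θ η)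
    (hsing : RandomTransport.AreMutuallySingular P ξ η)
    (hdiff : RandomTransport.IsDiffuse P ξ)
    (hfin : RandomTransport.intensity P ξ < ∞)
    (hint : RandomTransport.intensity P ξ = RandomTransport.intensity P η)
    (hrec : P Set.univ = ∞ → ∀ᵐ ω ∂P, ξ ω Set.univ = 0 ∨ ξ ω Set.univ = ∞) :
    RandomTransport.IsAllocation P θ (RandomTransport.matching ξ η) ∧
      RandomTransport.Balances P ξ η (RandomTransport.matching ξ η) := by
  have hmatch : ∀ ω s, RandomTransport.matching ξ η ω s =
      RandomTransport.pathMatching (ξ ω) (η ω) s := fun _ _ => rfl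
  have hequiv : ∀ᵐ ω ∂P, ∀ s t : ℝ, RandomTransport.pathMatching (ξ (θ t ω)) (η (θ t ω)) (s - t) =
      RandomTransport.pathMatching (ξ ω) (η ω) s - (t : EReal) := by
    filter_upwards [hξinv, hηinv] with ω h1 h2 s t
    exact RandomTransport.pathMatching_shift (h1 t) (h2 t) s
  -- Joint measurability needs s-finite kernels; these agree with `ξ` and `η` almost surely.
  obtain ⟨ξ', hξ's, hξ'⟩ := RandomTransport.exists_sFinite_kernel ξ
  obtain ⟨η', hη's, hη'⟩ := RandomTransport.exists_sFinite_kernel η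
  have eξ : ∀ᵐ ω ∂P, ξ' ω = ξ ω := hξ.mono hξ'
  have eη : ∀ᵐ ω ∂P, η' ω = η ω := hη.mono hη'
  have locfin : ∀ μ : Measure ℝ, (∀ C, IsCompact C → μ C < ∞) → IsLocallyFiniteMeasure μ := by
    intro μ h
    have : IsFiniteMeasureOnCompacts μ := ⟨fun C hC => h C hC⟩
    infer_instance
  have covariant : ∀ {κ κ' : Kernel Ω ℝ}, RandomTransport.IsInvariant P θ κ →
      (∀ᵐ ω ∂P, κ' ω = κ ω) → RandomTransport.IsShiftCovariant P θ κ' := by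
    intro κ κ' hκ he t
    filter_upwards [hκ, he, (hstat t).quasiMeasurePreserving.ae he] with ω h1 h2 h3 C hC
    have h4 : MeasurableSet {x : ℝ | x - t ∈ C} := (measurable_id.sub_const t) hC
    rw [h2, h3, ← h1 t _ h4]
    simp only [Set.mem_ofPred_eq, add_sub_cancel_right, Set.ofPred_mem_eq]
  obtain ⟨g, hg, hgeq⟩ := RandomTransport.exists_measurable_pathMatching ξ' η'
  have hgm : ∀ᵐ ω ∂P, ∀ s, RandomTransport.pathMatching (ξ ω) (η ω) s = g (ω, s) := by
    filter_upwards [eξ, eη, hξ, hη, hdiff] with ω h1 h2 h3 h4 h5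
    rw [← h1, ← h2]
    exact hgeq ω (h1 ▸ locfin _ h3) (h2 ▸ locfin _ h4) (h1 ▸ h5)
  have hgm' : ∀ᵐ ω ∂P, ∀ s, RandomTransport.pathMatching (ξ' ω) (η' ω) s = g (ω, s) := by
    filter_upwards [eξ, eη, hgm] with ω h1 h2 h3
    rwa [h1, h2]
  have hginv : ∀ t : ℝ, ∀ᵐ ω ∂P, ∀ s, g (θ t ω, s - t) = g (ω, s) - t := by
    intro t
    filter_upwards [hequiv, hgm, (hstat t).quasiMeasurePreserving.ae hgm] with ω h1 h2 h3 s
    rw [← h2, ← h3, h1]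
  have intensity_congr : ∀ {κ κ' : Kernel Ω ℝ}, (∀ᵐ ω ∂P, κ' ω = κ ω) →
      RandomTransport.intensity P κ' = RandomTransport.intensity P κ := fun he =>
    lintegral_congr_ae (he.mono fun ω h => by simp only [h])
  obtain ⟨h1, h2⟩ := RandomTransport.ae_balances hθ hstat herg (ξ := ξ') (η := η')
    (by filter_upwards [eξ, hξ] with ω h3 h4 using h3 ▸ locfin _ h4)
    (by filter_upwards [eη, hη] with ω h3 h4 using h3 ▸ locfin _ h4)
    (covariant hξinv eξ) (covariant hηinv eη)
    (by filter_upwards [eξ, eη, hsing] with ω h3 h4 h5 using by rwa [h3, h4])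
    (by filter_upwards [eξ, hdiff] with ω h3 h4 using by rwa [h3])
    (by rwa [intensity_congr eξ]) (by rw [intensity_congr eξ, intensity_congr eη, hint])
    (fun hP => by filter_upwards [eξ, hrec hP] with ω h3 h4 using by rwa [h3])
    hg hgm' hginv
  refine ⟨⟨fun ω s => ?_, ⟨g, hg, hgm⟩, hequiv⟩, ⟨?_, ?_⟩⟩
  · exact ((EReal.bot_lt_coe s).trans_le (RandomTransport.le_pathMatching _ _ s)).ne'
  · filter_upwards [eξ, hgm, h1] with ω h3 h4 h5
    simpa only [hmatch, h4, h3] using h5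
  · filter_upwards [eξ, eη, hgm, h2] with ω h3 h4 h5 h6 C hC
    simpa only [hmatch, h5, h3, h4] using h6 C hC
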